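/- Let $M$ be a smooth $n$-dimensional manifold with tangent bundle $\pi:TM\to M$, and let $A\subset TM\setminus\mathbf 0$ be an open subset of $TM$ with $\pi(A)=M$ and $\lambda v\in A$ for all $v\in A$, $\lambda>0$. Let $L:A\to\mathbb R$ be a pseudo-Finsler metric: $L$ is smooth, $L(\lambda v)=\lambda^2L(v)$ for all $v\in A$, $\lambda>0$, and for every $v\in A$ the fundamental tensor $$g_v(u,w)=\tfrac12\,\frac{\partial^2}{\partial t\,\partial s}L(v+tu+sw)\Big|_{t=s=0},\qquad u,w\in T_{\pi(v)}M,$$ is nondegenerate. Put $C_v(w_1,w_2,w_3)=\frac14\frac{\partial^3}{\partial s_3\partial s_2\partial s_1}L\big(v+\sum_i s_iw_i\big)\big|_{s_1=s_2=s_3=0}$. For a vector field $V$ on an open subset of $M$ with values in $A$, let $\nabla^V$ be the Chern connection, i.e. the unique torsion-free affine connection with $X(g_V(Y,Z))=g_V(\nabla^V_XY,Z)+g_V(Y,\nabla^V_XZ)+2C_V(\nabla^V_XV,Y,Z)$; its Christoffel symbols in a chart have the form $\Gamma^k_{ij}(V)$ for functions $\Gamma^k_{ij}$ on the part of $A$ over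 the chart domain. For a smooth curve $c$ in $M$, a vector field $W$ along $c$ with values in $A$ and a vector field $X$ along $c$, let $D^W_cX$ be the vector field along $c$ with components $\dot X^k+\sum_{i,j}X^i\dot c^j\,\Gamma^k_{ij}(W)$. Let $a<b$ and let $\gamma:[a,b]\to M$ be a geodesic, i.e. a smooth curve with $\dot\gamma(t)\in A$ for all $t\in[a,b]$ and $D^{\dot\gamma}_\gamma\dot\gamma=0$. For a vector field $X$ along $\gamma$ write $X'=D^{\dot\gamma}_\gamma X$. For smooth vector fields $W,Z$ along $\gamma$, choose a smooth map $\Lambda:[a,b]\times(-\varepsilon,\varepsilon)\to M$ with $\Lambda(\cdot,0)=\gamma$, $\Lambda_s(\cdot,0)=W$ and $\Lambda_t\in A$ everywhere, and a smooth vector field $\tilde Z$ along $\Lambda$ extending $Z$; writing $\gamma_s=\Lambda(\cdot,s)$ and $\beta_t=\Lambda(t,\cdot)$, let $$R^\gamma(\dot\gamma,W)Z=\Big(D^{\Lambda_t}_{\gamma_s}D^{\Lambda_t}_{\beta_t}\tilde Z-D^{\Lambda_t}_{\beta_t}D^{\Lambda_t}_{\gamma_s}\tilde Z\Big)\Big|_{s=0},$$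 which does not depend on the choice of $\Lambda$ and $\tilde Z$. A Jacobi field along $\gamma$ is a smooth vector field $J$ along $\gamma$ with $J''=R^\gamma(\dot\gamma,J)\dot\gamma$. If $J_1$ and $J_2$ are Jacobi fields along $\gamma$, then the function $$g_{\dot\gamma}(J_1,J_2')-g_{\dot\gamma}(J_1',J_2)$$ is constant on $[a,b]$. -/

import Mathlib

open Set Manifold
open scoped ContDiff

noncomputable section

/-! ### Fibrewise derivatives -/

section Fibre

variable {V : Type*} [AddCommGroup V] [Module ℝ V]

/-- `½ ∂²/∂t∂s f (y + t u + s w)` at `t = s = 0`, for a function `f` on a real vector space. -/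
def fibreHessian (f : V → ℝ) (y u w : V) : ℝ :=
  1 / 2 * deriv (fun t : ℝ => deriv (fun s : ℝ => f (y + t • u + s • w)) 0) 0

/-- `¼ ∂³/∂s₃∂s₂∂s₁ f (y + s₁ w₁ + s₂ w₂ + s₃ w₃)` at `s₁ = s₂ = s₃ = 0`. -/
def fibreCartan (f : V → ℝ) (y w₁ w₂ w₃ : V) : ℝ :=
  1 / 4 * deriv (fun s₃ : ℝ => deriv (fun s₂ : ℝ => deriv (fun s₁ : ℝ =>
    f (y + s₁ • w₁ + s₂ • w₂ + s₃ • w₃)) 0) 0) 0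

end Fibre

/-! ### The Chern connection in a chart

Here `ℓ x y` is the expression of a pseudo-Finsler metric in a chart: `x` is the vector of
coordinates of the base point and `y` the vector of components of the tangent vector. -/

section Local

variable {E : Type*} [NormedAddCommGroup E] [NormedSpace ℝ E]

/-- `G` is the system of Christoffel symbols at `(x, y)` of the Chern connection of `ℓ`, written
as a map `(X, Y) ↦ G X Y` whose value has components `∑ Γᵏᵢⱼ(x, y) Xⁱ Yʲ`; thus
`∇^V_X Y = ∂_X Y + G X Y` at `x` whenever `V x = y`.

The two conditions are the two defining properties of the Chern connection `∇^V`, evaluated at `x`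
for vector fields `V, X, Y, Z` with constant components in the chart and `V = y`:

* torsion-freeness `∇^V_X Y - ∇^V_Y X = [X, Y]` (here `[X, Y] = 0`);
* almost metric compatibility
  `X (g_V(Y, Z)) = g_V(∇^V_X Y, Z) + g_V(Y, ∇^V_X Z) + 2 C_V(∇^V_X V, Y, Z)`.

(For fields with variable components both sides of each identity change by the same amount. In
particular, a variable `V` with `V x = y` adds `2 C_V(∂_X V, Y, Z)` to both sides of the second
one.) When `ℓ` is a pseudo-Finsler metric there is exactly one such `G`, and it is bilinear. -/
def IsChernSymbol (ℓ : E → E → ℝ) (x y : E) (G : E → E → E) : Prop :=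
  (∀ X Y : E, G X Y = G Y X) ∧
  ∀ X Y Z : E,
    deriv (fun r : ℝ => fibreHessian (ℓ (x + r • X)) y Y Z) 0 =
      fibreHessian (ℓ x) y (G X Y) Z + fibreHessian (ℓ x) y Y (G X Z)
        + 2 * fibreCartan (ℓ x) y (G X y) Y Z

/-- The Christoffel symbols of the Chern connection at `(x, y)`, in a chart. -/
def chernSymbol (ℓ : E → E → ℝ) (x y : E) : E → E → E :=
  Classical.epsilon (IsChernSymbol ℓ x y)

end Local

/-! ### Curves in a manifold -/

section Curves

variable {E : Type*} [NormedAddCommGroup E] [NormedSpace ℝ E]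
  {M : Type*} [TopologicalSpace M] [ChartedSpace E M]

/-- The velocity at `t` of a curve `c` defined on the interval `S`. -/
def velocity (S : Set ℝ) (c : ℝ → M) (t : ℝ) : TangentSpace 𝓘(ℝ, E) (c t) :=
  mfderivWithin 𝓘(ℝ, ℝ) 𝓘(ℝ, E) c S t (1 : ℝ)

variable [IsManifold 𝓘(ℝ, E) ∞ M]

/-- Smooth vector fields along a curve `c` defined on the interval `S`. -/
def IsSmoothAlong (S : Set ℝ) (c : ℝ → M) (X : ∀ t, TangentSpace 𝓘(ℝ, E) (c t)) : Prop :=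
  ContMDiffOn 𝓘(ℝ, ℝ) 𝓘(ℝ, E).tangent ∞
    (fun t => (⟨c t, X t⟩ : TangentBundle 𝓘(ℝ, E) M)) S

end Curves

/-! ### Pseudo-Finsler manifolds -/

/-- A (conic, two-homogeneous) pseudo-Finsler metric on the manifold `M`. The metric is defined on
the conic open set `A`; the values of the function `L` outside of `A` are irrelevant. -/
structure PseudoFinsler (E : Type*) [NormedAddCommGroup E] [NormedSpace ℝ E]
    (M : Type*) [TopologicalSpace M] [ChartedSpace E M] [IsManifold 𝓘(ℝ, E) ∞ M] where
  A : Set (TangentBundle 𝓘(ℝ, E) M)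
  L : TangentBundle 𝓘(ℝ, E) M → ℝ
  isOpen_A : IsOpen A
  zero_notMem : ∀ p : M, (⟨p, 0⟩ : TangentBundle 𝓘(ℝ, E) M) ∉ A
  exists_mem : ∀ p : M, ∃ v : TangentSpace 𝓘(ℝ, E) p, (⟨p, v⟩ : TangentBundle 𝓘(ℝ, E) M) ∈ A
  smul_mem : ∀ (p : M) (v : TangentSpace 𝓘(ℝ, E) p) (r : ℝ), 0 < r →
    (⟨p, v⟩ : TangentBundle 𝓘(ℝ, E) M) ∈ A → (⟨p, r • v⟩ : TangentBundle 𝓘(ℝ, E) M) ∈ A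
  smooth_L : ContMDiffOn 𝓘(ℝ, E).tangent 𝓘(ℝ, ℝ) ∞ L A
  homogeneous : ∀ (p : M) (v : TangentSpace 𝓘(ℝ, E) p) (r : ℝ), 0 < r →
    (⟨p, v⟩ : TangentBundle 𝓘(ℝ, E) M) ∈ A → L ⟨p, r • v⟩ = r ^ 2 * L ⟨p, v⟩
  nondegenerate : ∀ (p : M) (v : TangentSpace 𝓘(ℝ, E) p),
    (⟨p, v⟩ : TangentBundle 𝓘(ℝ, E) M) ∈ A → ∀ u : TangentSpace 𝓘(ℝ, E) p,
      (∀ w : TangentSpace 𝓘(ℝ, E) p, fibreHessian (fun z => L ⟨p, z⟩) v u w = 0) → u = 0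

namespace PseudoFinsler

variable {E : Type*} [NormedAddCommGroup E] [NormedSpace ℝ E]
  {M : Type*} [TopologicalSpace M] [ChartedSpace E M] [IsManifold 𝓘(ℝ, E) ∞ M]
  (F : PseudoFinsler E M)

/-- The fundamental tensor `g_v(u, w)`, for `v, u, w` in `T_p M`. -/
def fundamentalTensor {p : M} (v u w : TangentSpace 𝓘(ℝ, E) p) : ℝ :=
  fibreHessian (fun z : TangentSpace 𝓘(ℝ, E) p => F.L ⟨p, z⟩) v u w

/-- The expression of `L` in the preferred chart `φ` at `p`: the value of `L` at the tangent vector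
with base point `φ⁻¹ x` and components `y`. -/
def localExpr (p : M) (x y : E) : ℝ :=
  F.L (tangentMap 𝓘(ℝ, E) 𝓘(ℝ, E) (chartAt E p).symm ⟨x, y⟩)

/-- The covariant derivative `D_c^W X` at `t`, induced by the Chern connection, along the curve `c`
defined on the interval `S`. It is computed in the preferred chart at `c t`, as
`Ẋᵏ + ∑ Xⁱ ċʲ Γᵏᵢⱼ(W)`; recall that in Mathlib a vector tangent to `M` at `q` is, by definition,
the vector of its components in the preferred chart at `q`. -/
def covDeriv (S : Set ℝ) (c : ℝ → M) (W X : ∀ t, TangentSpace 𝓘(ℝ, E) (c t)) (t : ℝ) :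
    TangentSpace 𝓘(ℝ, E) (c t) :=
  (derivWithin (fun τ => (mfderiv 𝓘(ℝ, E) 𝓘(ℝ, E) (chartAt E (c t)) (c τ) (X τ) : E)) S t
    + chernSymbol (F.localExpr (c t)) (chartAt E (c t) (c t)) (W t)
        (X t) (velocity (E := E) S c t) : E)

/-- The covariant derivative `X' = D_γ^γ̇ X` of a vector field along `γ : [a, b] → M`, with the
velocity of `γ` as reference vector. -/
def covDerivVelocity (a b : ℝ) (γ : ℝ → M) (X : ∀ t, TangentSpace 𝓘(ℝ, E) (γ t)) :
    ∀ t, TangentSpace 𝓘(ℝ, E) (γ t) :=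
  F.covDeriv (Icc a b) γ (velocity (Icc a b) γ) X

/-- `γ : [a, b] → M` is a geodesic: a smooth `L`-admissible curve with parallel velocity. -/
structure IsGeodesic (a b : ℝ) (γ : ℝ → M) : Prop where
  smooth : ContMDiffOn 𝓘(ℝ, ℝ) 𝓘(ℝ, E) ∞ γ (Icc a b)
  admissible : ∀ t ∈ Icc a b,
    (⟨γ t, velocity (Icc a b) γ t⟩ : TangentBundle 𝓘(ℝ, E) M) ∈ F.A
  parallel : ∀ t ∈ Icc a b, F.covDerivVelocity a b γ (velocity (Icc a b) γ) t = 0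

/-! ### Variations and the Jacobi operator -/

/-- The velocities `Λ_t(t, s)` of the longitudinal curves of a variation. -/
def longVelocity (a b : ℝ) (Λ : ℝ → ℝ → M) (t s : ℝ) : TangentSpace 𝓘(ℝ, E) (Λ t s) :=
  velocity (Icc a b) (fun τ => Λ τ s) t

/-- The velocities `Λ_s(t, s)` of the transverse curves of a variation. -/
def transVelocity (ε : ℝ) (Λ : ℝ → ℝ → M) (t s : ℝ) : TangentSpace 𝓘(ℝ, E) (Λ t s) :=
  velocity (Ioo (-ε) ε) (fun σ => Λ t σ) s

/-- The covariant derivative of `Z` along the longitudinal curves `t ↦ Λ(t, s)`, with `Λ_t` as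
reference vector. -/
def longDeriv (a b : ℝ) (Λ : ℝ → ℝ → M) (Z : ∀ t s, TangentSpace 𝓘(ℝ, E) (Λ t s)) (t s : ℝ) :
    TangentSpace 𝓘(ℝ, E) (Λ t s) :=
  F.covDeriv (Icc a b) (fun τ => Λ τ s) (fun τ => longVelocity a b Λ τ s) (fun τ => Z τ s) t

/-- The covariant derivative of `Z` along the transverse curves `s ↦ Λ(t, s)`, with `Λ_t` as
reference vector. -/
def transDeriv (a b ε : ℝ) (Λ : ℝ → ℝ → M) (Z : ∀ t s, TangentSpace 𝓘(ℝ, E) (Λ t s))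
    (t s : ℝ) : TangentSpace 𝓘(ℝ, E) (Λ t s) :=
  F.covDeriv (Ioo (-ε) ε) (fun σ => Λ t σ) (fun σ => longVelocity a b Λ t σ) (fun σ => Z t σ) s

/-- `R^Λ(Z)`: the commutator of the longitudinal and the transverse covariant derivative. -/
def variationCurvature (a b ε : ℝ) (Λ : ℝ → ℝ → M)
    (Z : ∀ t s, TangentSpace 𝓘(ℝ, E) (Λ t s)) (t s : ℝ) : TangentSpace 𝓘(ℝ, E) (Λ t s) :=
  F.longDeriv a b Λ (F.transDeriv a b ε Λ Z) t s - F.transDeriv a b ε Λ (F.longDeriv a b Λ Z) t s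

/-- `Λ : [a, b] × (-ε, ε) → M` is a smooth `L`-admissible variation of `γ : [a, b] → M` with
variational vector field `W`. (The equality of tangent vectors in `variation` includes the equality
`Λ(t, 0) = γ(t)` of their base points.) -/
structure IsVariation (a b ε : ℝ) (γ : ℝ → M) (W : ∀ t, TangentSpace 𝓘(ℝ, E) (γ t))
    (Λ : ℝ → ℝ → M) : Prop where
  pos : 0 < ε
  smooth : ContMDiffOn 𝓘(ℝ, ℝ × ℝ) 𝓘(ℝ, E) ∞ (fun z : ℝ × ℝ => Λ z.1 z.2)
    (Icc a b ×ˢ Ioo (-ε) ε)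
  admissible : ∀ t ∈ Icc a b, ∀ s ∈ Ioo (-ε) ε,
    (⟨Λ t s, longVelocity a b Λ t s⟩ : TangentBundle 𝓘(ℝ, E) M) ∈ F.A
  variation : ∀ t ∈ Icc a b,
    (⟨Λ t 0, transVelocity ε Λ t 0⟩ : TangentBundle 𝓘(ℝ, E) M) = ⟨γ t, W t⟩

/-- `Z'` is a smooth vector field along the variation `Λ` that extends the vector field `Z` along
`γ`. -/
structure IsExtension (a b ε : ℝ) (γ : ℝ → M) (Z : ∀ t, TangentSpace 𝓘(ℝ, E) (γ t))
    (Λ : ℝ → ℝ → M) (Z' : ∀ t s, TangentSpace 𝓘(ℝ, E) (Λ t s)) : Prop where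
  smooth : ContMDiffOn 𝓘(ℝ, ℝ × ℝ) 𝓘(ℝ, E).tangent ∞
    (fun z : ℝ × ℝ => (⟨Λ z.1 z.2, Z' z.1 z.2⟩ : TangentBundle 𝓘(ℝ, E) M))
    (Icc a b ×ˢ Ioo (-ε) ε)
  extends_eq : ∀ t ∈ Icc a b,
    (⟨Λ t 0, Z' t 0⟩ : TangentBundle 𝓘(ℝ, E) M) = ⟨γ t, Z t⟩

/-- `R` is the vector field `R^γ(γ̇, W) Z` along `γ`: it is the restriction to `s = 0` of
`R^Λ(Z')`, where `Λ` is an `L`-admissible variation of `γ` with variational vector field `W` and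
`Z'` a smooth extension of `Z` to `Λ`. (Such `Λ` and `Z'` always exist, and the result does not
depend on their choice.) -/
def IsJacobiOperator (a b : ℝ) (γ : ℝ → M) (W Z R : ∀ t, TangentSpace 𝓘(ℝ, E) (γ t)) : Prop :=
  ∃ (ε : ℝ) (Λ : ℝ → ℝ → M) (Z' : ∀ t s, TangentSpace 𝓘(ℝ, E) (Λ t s)),
    F.IsVariation a b ε γ W Λ ∧ IsExtension a b ε γ Z Λ Z' ∧
    ∀ t ∈ Icc a b, (⟨Λ t 0, F.variationCurvature a b ε Λ Z' t 0⟩ : TangentBundle 𝓘(ℝ, E) M)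
      = ⟨γ t, R t⟩

/-- `J` is a Jacobi field along `γ : [a, b] → M`: a smooth vector field along `γ` with
`J'' = R^γ(γ̇, J) γ̇`. -/
structure IsJacobiField (a b : ℝ) (γ : ℝ → M) (J : ∀ t, TangentSpace 𝓘(ℝ, E) (γ t)) : Prop where
  smooth : IsSmoothAlong (Icc a b) γ J
  jacobi : F.IsJacobiOperator a b γ J (velocity (Icc a b) γ)
    (F.covDerivVelocity a b γ (F.covDerivVelocity a b γ J))

end PseudoFinsler

end

/-! The bilinear expression in the theorem is the canonical symplectic form of the Lagrangian `L`,
and Jacobi fields are the solutions of the linearized Euler-Lagrange equation, on which that form is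
conserved. Antisymmetry of the curvature operator is never proved or used; only symmetry of second
derivatives enters.

In a chart let `ℓ` be the expression of `L`, `D²ℓ` its full second derivative on `E × E`, and `y`
the reference vector. Homogeneity makes the Cartan tensor vanish when one argument is `y`. Setting
one argument of the metric identity to `y` therefore gives `∂_X ∂_a ℓ = D²ℓ(Γ(X, y), a) + D²ℓ(y,
Γ(X, a))`, with `Γ(X, y)`, `a`, `y` and `Γ(X, a)` inserted vertically on the right
(`secondDeriv_chernMap_snd`). Two consequences follow. The geodesic equation is the Euler-Lagrange
equation of `ℓ` (`secondDeriv_chernMap_snd_snd`). Twice the function of the theorem equals `D²ℓ(J₂,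
J̇₂)(0, J₁) - D²ℓ(J₁, J̇₁)(0, J₂)`, because the terms with `Γ(J₁, J₂)` cancel (`secondDeriv_skew`).

For a Jacobi field take the variation and the extension that compute the curvature term. Replacing
the extension by the actual velocity changes nothing, since covariant derivatives commute on fields
vanishing along the central curve. Torsion-freeness then turns the Jacobi equation into the
statement that the geodesic equation holds to first order in the variation parameter
(`partialSnd_longDerivLocal_eq_zero`). Differentiating Euler-Lagrange in that parameter gives `d/dt
D²ℓ(J, J̇)(0, e) = D²ℓ(J, J̇)(e, 0)` for constant `e` (`hasDerivWithinAt_secondDeriv`). Hence `d/dt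
D²ℓ(J, J̇)(0, K) = D²ℓ(J, J̇)(K, K̇)`, which is symmetric in the two fields, so the form has zero
derivative (`hasDerivWithinAt_symplectic`).

The rest passes between `M` and charts. The symbols selected by choice are identified with the
explicit smooth map `chernMap`, its inhomogeneous transformation law is derived, and
`tangentComp_covDeriv` concludes that covariant derivatives may be computed in any one fixed chart.
-/

noncomputable section

set_option maxSynthPendingDepth 5

/-! ### Total derivatives of a metric in a chart, and homogeneity. -/

section LocalFinsler

variable {E : Type*} [NormedAddCommGroup E] [NormedSpace ℝ E]

/-- The expression `ℓ` of a pseudo-Finsler metric in a chart, with domain `U`. Of the homogeneity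
only Euler's relation is recorded. -/
structure IsLocalPseudoFinsler (ℓ : E → E → ℝ) (U : Set (E × E)) : Prop where
  isOpen : IsOpen U
  smooth : ContDiffOn ℝ ∞ (Function.uncurry ℓ) U
  euler : ∀ z ∈ U, fderiv ℝ (Function.uncurry ℓ) z (0, z.2) = 2 * Function.uncurry ℓ z
  nondegenerate : ∀ z ∈ U, ∀ u : E, (∀ w : E, fibreHessian (ℓ z.1) z.2 u w = 0) → u = 0

/-- The total first derivative of `ℓ`. -/
def firstDeriv (ℓ : E → E → ℝ) : E × E → E × E →L[ℝ] ℝ :=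
  fderiv ℝ (Function.uncurry ℓ)

/-- The total second derivative of `ℓ`. -/
def secondDeriv (ℓ : E → E → ℝ) : E × E → E × E →L[ℝ] E × E →L[ℝ] ℝ :=
  fderiv ℝ (firstDeriv ℓ)

/-- The total third derivative of `ℓ`. -/
def thirdDeriv (ℓ : E → E → ℝ) : E × E → E × E →L[ℝ] E × E →L[ℝ] E × E →L[ℝ] ℝ :=
  fderiv ℝ (secondDeriv ℓ)

namespace IsLocalPseudoFinsler

variable {ℓ : E → E → ℝ} {U : Set (E × E)} (h : IsLocalPseudoFinsler ℓ U) {z : E × E}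
include h

theorem contDiffOn_firstDeriv : ContDiffOn ℝ ∞ (firstDeriv ℓ) U :=
  h.smooth.fderiv_of_isOpen h.isOpen (by simp)

theorem contDiffOn_secondDeriv : ContDiffOn ℝ ∞ (secondDeriv ℓ) U :=
  h.contDiffOn_firstDeriv.fderiv_of_isOpen h.isOpen (by simp)

theorem contDiffOn_thirdDeriv : ContDiffOn ℝ ∞ (thirdDeriv ℓ) U :=
  h.contDiffOn_secondDeriv.fderiv_of_isOpen h.isOpen (by simp)

theorem hasFDerivAt (hz : z ∈ U) : HasFDerivAt (Function.uncurry ℓ) (firstDeriv ℓ z) z :=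
  ((h.smooth.contDiffAt (h.isOpen.mem_nhds hz)).differentiableAt (by simp)).hasFDerivAt

theorem hasFDerivAt_firstDeriv (hz : z ∈ U) :
    HasFDerivAt (firstDeriv ℓ) (secondDeriv ℓ z) z :=
  ((h.contDiffOn_firstDeriv.contDiffAt (h.isOpen.mem_nhds hz)).differentiableAt
    (by simp)).hasFDerivAt

theorem hasFDerivAt_secondDeriv (hz : z ∈ U) :
    HasFDerivAt (secondDeriv ℓ) (thirdDeriv ℓ z) z :=
  ((h.contDiffOn_secondDeriv.contDiffAt (h.isOpen.mem_nhds hz)).differentiableAt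
    (by simp)).hasFDerivAt

theorem secondDeriv_comm (hz : z ∈ U) (a b : E × E) :
    secondDeriv ℓ z a b = secondDeriv ℓ z b a :=
  ((h.smooth.contDiffAt (h.isOpen.mem_nhds hz)).isSymmSndFDerivAt
      (by simp; exact WithTop.coe_le_coe.2 (le_top (a := (2 : ℕ∞))))).eq a b

theorem thirdDeriv_comm_left (hz : z ∈ U) (a b c : E × E) :
    thirdDeriv ℓ z a b c = thirdDeriv ℓ z b a c :=
  congrArg (fun φ : E × E →L[ℝ] ℝ => φ c)
    (((h.contDiffOn_firstDeriv.contDiffAt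
      (h.isOpen.mem_nhds hz)).isSymmSndFDerivAt
      (by simp; exact WithTop.coe_le_coe.2 (le_top (a := (2 : ℕ∞))))).eq a b)

/-- The symmetry of the second derivative holds on an open set, so it can be differentiated. -/
theorem thirdDeriv_comm_right (hz : z ∈ U) (a b c : E × E) :
    thirdDeriv ℓ z a b c = thirdDeriv ℓ z a c b := by
  have h1 : ∀ b c : E × E, HasFDerivAt (fun z => secondDeriv ℓ z b c)
      (((thirdDeriv ℓ z).flip b).flip c) z := fun b c => by
    have := ((h.hasFDerivAt_secondDeriv hz).clm_apply (hasFDerivAt_const b z)).clm_apply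
      (hasFDerivAt_const c z)
    refine this.congr_fderiv ?_
    ext <;> simp
  have h2 := (h1 c b).congr_of_eventuallyEq (f₁ := fun z => secondDeriv ℓ z b c)
    (Filter.eventually_of_mem (h.isOpen.mem_nhds hz) fun z' hz' => h.secondDeriv_comm hz' b c)
  exact congrArg (fun φ : E × E →L[ℝ] ℝ => φ a) ((h1 b c).unique h2)

theorem fibreHessian_eq {x y : E} (hz : (x, y) ∈ U) (u w : E) :
    fibreHessian (ℓ x) y u w = 1 / 2 * secondDeriv ℓ (x, y) (0, u) (0, w) := by
  have hline : ∀ᶠ t : ℝ in nhds 0, (x, y + t • u) ∈ U := by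
    have : ContinuousAt (fun t : ℝ => (x, y + t • u)) 0 := by fun_prop
    exact this.eventually_mem (h.isOpen.mem_nhds (by simpa using hz))
  have h1 : (fun t : ℝ => deriv (fun s : ℝ => ℓ x (y + t • u + s • w)) 0)
      =ᶠ[nhds 0] fun t => firstDeriv ℓ ((x, y) + t • (0, u)) (0, w) := by
    filter_upwards [hline] with t ht
    have := ((h.hasFDerivAt ht).hasLineDerivAt (0, w))
    have h3 : HasDerivAt (fun s : ℝ => ℓ x (y + t • u + s • w))
        (firstDeriv ℓ (x, y + t • u) (0, w)) 0 := by
      refine HasDerivAt.congr_of_eventuallyEq this (Filter.Eventually.of_forall fun s => ?_)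
      simp [Function.uncurry]
    rw [h3.deriv]
    simp
  have h2 : HasDerivAt (fun t : ℝ => firstDeriv ℓ ((x, y) + t • (0, u)) (0, w))
      (secondDeriv ℓ (x, y) (0, u) (0, w)) 0 := by
    have := ((h.hasFDerivAt_firstDeriv hz).hasLineDerivAt (0, u))
    exact (HasDerivAt.clm_apply this (hasDerivAt_const (0 : ℝ) ((0 : E), w))).congr_deriv (by simp)
  rw [fibreHessian, h1.deriv_eq, h2.deriv]

theorem hasLineDerivAt_secondDeriv (hz : z ∈ U) (a b c : E × E) :
    HasDerivAt (fun t : ℝ => secondDeriv ℓ (z + t • a) b c) (thirdDeriv ℓ z a b c) 0 := by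
  have h1 : HasDerivAt (fun t : ℝ => secondDeriv ℓ (z + t • a)) (thirdDeriv ℓ z a) 0 :=
    (h.hasFDerivAt_secondDeriv hz).hasLineDerivAt a
  refine ((h1.clm_apply (hasDerivAt_const (0 : ℝ) b)).clm_apply
    (hasDerivAt_const (0 : ℝ) c)).congr_deriv (by simp)

/-- For fixed outer parameter `t` the two inner derivatives are twice a `fibreHessian` at the base
vector `y + t • w`; what remains is a line derivative of `secondDeriv`. -/
theorem fibreCartan_eq {x y : E} (hz : (x, y) ∈ U) (u v w : E) :
    fibreCartan (ℓ x) y u v w = 1 / 4 * thirdDeriv ℓ (x, y) (0, u) (0, v) (0, w) := by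
  have hline : ∀ᶠ t : ℝ in nhds 0, (x, y + t • w) ∈ U := by
    have : ContinuousAt (fun t : ℝ => (x, y + t • w)) 0 := by fun_prop
    exact this.eventually_mem (h.isOpen.mem_nhds (by simpa using hz))
  have h1 : (fun t : ℝ => deriv (fun s : ℝ => deriv (fun r : ℝ =>
        ℓ x (y + r • u + s • v + t • w)) 0) 0)
      =ᶠ[nhds 0] fun t => secondDeriv ℓ ((x, y) + t • (0, w)) (0, v) (0, u) := by
    filter_upwards [hline] with t ht
    have h2 := h.fibreHessian_eq ht v u
    have h3 : (fun s : ℝ => deriv (fun r : ℝ => ℓ x (y + r • u + s • v + t • w)) 0) =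
        fun s : ℝ => deriv (fun r : ℝ => ℓ x (y + t • w + s • v + r • u)) 0 := by
      funext s
      congr 1
      funext r
      congr 1
      abel
    rw [fibreHessian] at h2
    rw [h3]
    simp only [Prod.smul_mk, smul_zero, Prod.mk_add_mk, add_zero]
    linarith
  rw [fibreCartan, h1.deriv_eq, (h.hasLineDerivAt_secondDeriv hz (0, w) (0, v) (0, u)).deriv,
    h.thirdDeriv_comm_left hz, h.thirdDeriv_comm_right hz, h.thirdDeriv_comm_left hz]

theorem deriv_fibreHessian {x y : E} (hz : (x, y) ∈ U) (X Y Z : E) :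
    deriv (fun r : ℝ => fibreHessian (ℓ (x + r • X)) y Y Z) 0 =
      1 / 2 * thirdDeriv ℓ (x, y) (X, 0) (0, Y) (0, Z) := by
  have hline : ∀ᶠ t : ℝ in nhds 0, (x + t • X, y) ∈ U := by
    have : ContinuousAt (fun t : ℝ => (x + t • X, y)) 0 := by fun_prop
    exact this.eventually_mem (h.isOpen.mem_nhds (by simpa using hz))
  have h1 : (fun r : ℝ => fibreHessian (ℓ (x + r • X)) y Y Z) =ᶠ[nhds 0]
      fun t => 1 / 2 * secondDeriv ℓ ((x, y) + t • (X, 0)) (0, Y) (0, Z) := by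
    filter_upwards [hline] with t ht
    rw [h.fibreHessian_eq ht]
    simp
  rw [h1.deriv_eq]
  exact ((h.hasLineDerivAt_secondDeriv hz (X, 0) (0, Y) (0, Z)).const_mul (1 / 2)).deriv

/-! ### Consequences of Euler's relation -/

/-- Euler's relation differentiated in the direction `a`. -/
theorem secondDeriv_snd (hz : z ∈ U) (a : E × E) :
    secondDeriv ℓ z a (0, z.2) + firstDeriv ℓ z (0, a.2) = 2 * firstDeriv ℓ z a := by
  have h0 : HasFDerivAt (fun z : E × E => ((0 : E), z.2))
      ((0 : E × E →L[ℝ] E).prod (ContinuousLinearMap.snd ℝ E E)) z :=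
    (hasFDerivAt_const (0 : E) z).prodMk hasFDerivAt_snd
  have h1 := (h.hasFDerivAt_firstDeriv hz).clm_apply h0
  have h2 := ((h.hasFDerivAt hz).const_mul (2 : ℝ)).congr_of_eventuallyEq
    (f₁ := fun z => firstDeriv ℓ z (0, z.2))
    (Filter.eventually_of_mem (h.isOpen.mem_nhds hz) fun z' hz' => h.euler z' hz')
  have h3 := congrArg (fun φ : E × E →L[ℝ] ℝ => φ a) (h1.unique h2)
  simp at h3
  linarith

theorem secondDeriv_vert_snd (hz : z ∈ U) (u : E) :
    secondDeriv ℓ z (0, u) (0, z.2) = firstDeriv ℓ z (0, u) := by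
  have := h.secondDeriv_snd hz (0, u)
  simp only at this
  linarith

theorem secondDeriv_horiz_snd (hz : z ∈ U) (X : E) :
    secondDeriv ℓ z (X, 0) (0, z.2) = 2 * firstDeriv ℓ z (X, 0) := by
  have := h.secondDeriv_snd hz (X, 0)
  have h0 : ((0 : E), (0 : E)) = 0 := rfl
  simp only [h0, map_zero] at this
  linarith

/-- The vertical first derivative is homogeneous of degree one, as `secondDeriv_vert_snd` expresses;
this is that relation differentiated in the direction `a`. -/
theorem thirdDeriv_snd (hz : z ∈ U) (a : E × E) (u : E) :
    thirdDeriv ℓ z a (0, u) (0, z.2) + secondDeriv ℓ z (0, u) (0, a.2) =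
      secondDeriv ℓ z a (0, u) := by
  have h0 : HasFDerivAt (fun z : E × E => ((0 : E), z.2))
      ((0 : E × E →L[ℝ] E).prod (ContinuousLinearMap.snd ℝ E E)) z :=
    (hasFDerivAt_const (0 : E) z).prodMk hasFDerivAt_snd
  have h1 := ((h.hasFDerivAt_secondDeriv hz).clm_apply
    (hasFDerivAt_const ((0 : E), u) z)).clm_apply h0
  have h2 := ((h.hasFDerivAt_firstDeriv hz).clm_apply
    (hasFDerivAt_const ((0 : E), u) z)).congr_of_eventuallyEq
    (f₁ := fun z => secondDeriv ℓ z (0, u) (0, z.2))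
    (Filter.eventually_of_mem (h.isOpen.mem_nhds hz) fun z' hz' => h.secondDeriv_vert_snd hz' u)
  have h3 := congrArg (fun φ : E × E →L[ℝ] ℝ => φ a) (h1.unique h2)
  simp at h3
  linarith

/-- The Cartan tensor annihilates the reference vector. This makes the implicit equations for the
Chern symbol solvable in stages. -/
theorem thirdDeriv_vert_snd (hz : z ∈ U) (v u : E) :
    thirdDeriv ℓ z (0, v) (0, u) (0, z.2) = 0 := by
  have := h.thirdDeriv_snd hz (0, v) u
  rw [h.secondDeriv_comm hz (0, v)] at this
  simpa using this

theorem thirdDeriv_horiz_snd (hz : z ∈ U) (X u : E) :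
    thirdDeriv ℓ z (X, 0) (0, u) (0, z.2) = secondDeriv ℓ z (X, 0) (0, u) := by
  have := h.thirdDeriv_snd hz (X, 0) u
  have h0 : ((0 : E), (0 : E)) = 0 := rfl
  simpa only [h0, map_zero, add_zero] using this

end IsLocalPseudoFinsler
end LocalFinsler

/-! ### The Chern connection in a chart: uniqueness, an explicit formula, smoothness. -/

section LocalChern

variable {E : Type*} [NormedAddCommGroup E] [NormedSpace ℝ E]

namespace IsLocalPseudoFinsler

variable {ℓ : E → E → ℝ} {U : Set (E × E)} (h : IsLocalPseudoFinsler ℓ U)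
include h

/-- Every term of the metric identity carries the same factor `1 / 2`, since `2 * (1 / 4) = 1 / 2`
in the Cartan term; it is cancelled here. -/
theorem isChernSymbol_iff {z : E × E} (hz : z ∈ U) (G : E → E → E) :
    IsChernSymbol ℓ z.1 z.2 G ↔ (∀ X Y, G X Y = G Y X) ∧ ∀ X Y Z,
      thirdDeriv ℓ z (X, 0) (0, Y) (0, Z) = secondDeriv ℓ z (0, G X Y) (0, Z)
        + secondDeriv ℓ z (0, Y) (0, G X Z) + thirdDeriv ℓ z (0, G X z.2) (0, Y) (0, Z) := by
  rw [IsChernSymbol]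
  refine and_congr_right fun _ => forall_congr' fun X => forall_congr' fun Y =>
    forall_congr' fun Z => ?_
  rw [h.deriv_fibreHessian hz, h.fibreHessian_eq hz, h.fibreHessian_eq hz, h.fibreCartan_eq hz]
  constructor <;> intro h <;> linarith

theorem eq_zero_of_secondDeriv {z : E × E} (hz : z ∈ U) {u : E}
    (hu : ∀ w, secondDeriv ℓ z (0, u) (0, w) = 0) : u = 0 :=
  h.nondegenerate z hz u fun w => by rw [h.fibreHessian_eq hz, hu, mul_zero]

/-- The difference `D` of two solutions is symmetric and solves the homogeneous metric identity. Its
Cartan term depends only on `D X y`, so one shows successively `D y y = 0`, `D X y = 0`, and `D =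
0`. -/
theorem isChernSymbol_unique {z : E × E} (hz : z ∈ U) {G G' : E → E → E}
    (hG : IsChernSymbol ℓ z.1 z.2 G) (hG' : IsChernSymbol ℓ z.1 z.2 G') : G = G' := by
  obtain ⟨hs, hm⟩ := (h.isChernSymbol_iff hz G).1 hG
  obtain ⟨hs', hm'⟩ := (h.isChernSymbol_iff hz G').1 hG'
  set y := z.2 with hy
  obtain ⟨D, hD⟩ : ∃ D : E → E → E, ∀ X Y, D X Y = G X Y - G' X Y := ⟨_, fun _ _ => rfl⟩
  have hvert : ∀ a b : E, ((0 : E), a - b) = (0, a) - (0, b) := fun a b => by simp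
  have Ds : ∀ X Y, D X Y = D Y X := fun X Y => by rw [hD, hD, hs, hs']
  have hsymm := fun a b : E => h.secondDeriv_comm hz (0, a) (0, b)
  have h0 : ∀ X Y Z, secondDeriv ℓ z (0, D X Y) (0, Z) + secondDeriv ℓ z (0, D X Z) (0, Y)
      + thirdDeriv ℓ z (0, D X y) (0, Y) (0, Z) = 0 := fun X Y Z => by
    have h1 := hm X Y Z
    have h2 := hm' X Y Z
    rw [hsymm Y] at h1 h2
    simp only [hD, hvert, map_sub, sub_apply]
    linarith
  have hT : ∀ u v, thirdDeriv ℓ z (0, u) (0, v) (0, y) = 0 := h.thirdDeriv_vert_snd hz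
  have h1 : ∀ X Z, secondDeriv ℓ z (0, D X y) (0, Z) + secondDeriv ℓ z (0, D X Z) (0, y) = 0 :=
    fun X Z => by
      have := h0 X Z y
      rw [hT] at this
      linarith
  have h2 : ∀ X, secondDeriv ℓ z (0, D X y) (0, y) = 0 := fun X => by linarith [h1 X y]
  have h3 : D y y = 0 := h.eq_zero_of_secondDeriv hz fun Z => by
    have h4 := h1 y Z
    rw [Ds y Z, h2, add_zero] at h4
    exact h4
  -- As `D y y = 0`, the identity in the direction `y` makes the pairing of `D X y` with `Z`
  -- antisymmetric in `X, Z`, while comparing `h1 X Z` with `h1 Z X` makes it symmetric.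
  have h4 : ∀ X, D X y = 0 := fun X => h.eq_zero_of_secondDeriv hz fun Z => by
    have h5 := h0 y X Z
    rw [h3] at h5
    have h00 : ((0 : E), (0 : E)) = 0 := rfl
    simp only [h00, map_zero, zero_apply, add_zero] at h5
    have h6 := h1 X Z
    have h7 := h1 Z X
    rw [Ds Z X] at h7
    rw [Ds y X, Ds y Z] at h5
    linarith
  have h5 : ∀ X Y Z, secondDeriv ℓ z (0, D X Y) (0, Z) + secondDeriv ℓ z (0, D X Z) (0, Y) = 0 :=
    fun X Y Z => by
      have h5 := h0 X Y Z
      rw [h4] at h5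
      have h00 : ((0 : E), (0 : E)) = 0 := rfl
      simpa only [h00, map_zero, zero_apply, add_zero] using h5
  funext X Y
  -- Koszul's argument: a trilinear expression symmetric in its first two slots and antisymmetric in
  -- its last two vanishes.
  have : D X Y = 0 := h.eq_zero_of_secondDeriv hz fun Z => by
    have e1 := h5 X Y Z
    have e2 := h5 Y Z X
    have e3 := h5 Z X Y
    rw [Ds Y X] at e2
    rw [Ds Z X, Ds Z Y] at e3
    linarith
  rw [hD, sub_eq_zero] at this
  exact this

theorem chernSymbol_eq {z : E × E} (hz : z ∈ U) {G : E → E → E}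
    (hG : IsChernSymbol ℓ z.1 z.2 G) : chernSymbol ℓ z.1 z.2 = G :=
  h.isChernSymbol_unique hz (Classical.epsilon_spec (p := IsChernSymbol ℓ z.1 z.2) ⟨G, hG⟩) hG

end IsLocalPseudoFinsler

/-! ### Existence and smoothness -/

/-- The vertical part of the second derivative of `ℓ`, i.e. twice the fundamental tensor. -/
def vertHessian (ℓ : E → E → ℝ) (z : E × E) : E →L[ℝ] E →L[ℝ] ℝ :=
  (secondDeriv ℓ z).bilinearComp (ContinuousLinearMap.inr ℝ E E) (ContinuousLinearMap.inr ℝ E E)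

@[simp] theorem vertHessian_apply (ℓ : E → E → ℝ) (z : E × E) (u w : E) :
    vertHessian ℓ z u w = secondDeriv ℓ z (0, u) (0, w) := rfl

/-- The inverse of `vertHessian`. -/
def sharp (ℓ : E → E → ℝ) (z : E × E) : (E →L[ℝ] ℝ) →L[ℝ] E := (vertHessian ℓ z).inverse

/-- The restriction of a covector on `E × E` to horizontal vectors. -/
def horizPart : (E × E →L[ℝ] ℝ) →L[ℝ] E →L[ℝ] ℝ :=
  (ContinuousLinearMap.compL ℝ E (E × E) ℝ).flip (ContinuousLinearMap.inl ℝ E E)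

/-- The restriction of a covector on `E × E` to vertical vectors. -/
def vertPart : (E × E →L[ℝ] ℝ) →L[ℝ] E →L[ℝ] ℝ :=
  (ContinuousLinearMap.compL ℝ E (E × E) ℝ).flip (ContinuousLinearMap.inr ℝ E E)

@[simp] theorem horizPart_apply (φ : E × E →L[ℝ] ℝ) (Z : E) : horizPart φ Z = φ (Z, 0) := rfl

@[simp] theorem vertPart_apply (φ : E × E →L[ℝ] ℝ) (Z : E) : vertPart φ Z = φ (0, Z) := rfl

/-- The value of the Chern symbol at `(y, y)`, where `y` is the reference vector. -/
def sprayVector (ℓ : E → E → ℝ) (z : E × E) : E :=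
  sharp ℓ z (vertPart (thirdDeriv ℓ z (z.2, 0) (0, z.2))
    - (1 / 2 : ℝ) • horizPart (thirdDeriv ℓ z (0, z.2) (0, z.2)))

omit [NormedSpace ℝ E] in
theorem mk_zero_add (a b : E) : ((0 : E), a + b) = (0, a) + (0, b) := by simp
omit [NormedSpace ℝ E] in
theorem mk_add_zero (a b : E) : (a + b, (0 : E)) = (a, 0) + (b, 0) := by simp
theorem mk_zero_smul (r : ℝ) (a : E) : ((0 : E), r • a) = r • (0, a) := by simp
theorem mk_smul_zero (r : ℝ) (a : E) : (r • a, (0 : E)) = r • (a, 0) := by simp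

variable [FiniteDimensional ℝ E]

/-- The nonlinear connection: the value of the Chern symbol at `(X, y)`, where `y` is the reference
vector. -/
def nonlinearConnection (ℓ : E → E → ℝ) (z : E × E) : E →L[ℝ] E :=
  LinearMap.toContinuousLinearMap
    { toFun := fun X => (1 / 2 : ℝ) • sharp ℓ z (vertPart (thirdDeriv ℓ z (X, 0) (0, z.2))
        + vertPart (thirdDeriv ℓ z (z.2, 0) (0, X)) - horizPart (thirdDeriv ℓ z (0, X) (0, z.2))
        - vertPart (thirdDeriv ℓ z (0, sprayVector ℓ z) (0, X)))
      map_add' := fun X Y => by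
        simp only [mk_zero_add, mk_add_zero, map_add, map_sub, add_apply, ← smul_add]
        congr 1
        abel
      map_smul' := fun r X => by
        simp only [mk_zero_smul, mk_smul_zero, map_smul, map_add, map_sub,
          smul_apply, RingHom.id_apply]
        module }

/-- The Chern symbol as a continuous bilinear map. -/
def chernMap (ℓ : E → E → ℝ) (z : E × E) : E →L[ℝ] E →L[ℝ] E :=
  LinearMap.toContinuousLinearMap <| LinearMap.toContinuousLinearMap.toLinearMap ∘ₗ
    LinearMap.mk₂ ℝ (fun X Y => (1 / 2 : ℝ) • sharp ℓ z
        (vertPart (thirdDeriv ℓ z (X, 0) (0, Y)) + vertPart (thirdDeriv ℓ z (Y, 0) (0, X))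
        - horizPart (thirdDeriv ℓ z (0, X) (0, Y))
        - vertPart (thirdDeriv ℓ z (0, nonlinearConnection ℓ z X) (0, Y))
        - vertPart (thirdDeriv ℓ z (0, nonlinearConnection ℓ z Y) (0, X))
        + vertPart (thirdDeriv ℓ z (0, X) (0, Y)) ∘L nonlinearConnection ℓ z))
      (fun X X' Y => by
        simp only [mk_zero_add, mk_add_zero, map_add, map_sub, add_apply,
          ContinuousLinearMap.add_comp, ← smul_add]
        congr 1
        abel)
      (fun r X Y => by
        simp only [mk_zero_smul, mk_smul_zero, map_smul, map_add, map_sub,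
          smul_apply, ContinuousLinearMap.smul_comp]
        module)
      (fun X Y Y' => by
        simp only [mk_zero_add, mk_add_zero, map_add, map_sub, add_apply,
          ContinuousLinearMap.add_comp, ← smul_add]
        congr 1
        abel)
      (fun r X Y => by
        simp only [mk_zero_smul, mk_smul_zero, map_smul, map_add, map_sub,
          smul_apply, ContinuousLinearMap.smul_comp]
        module)

theorem nonlinearConnection_apply (ℓ : E → E → ℝ) (z : E × E) (X : E) :
    nonlinearConnection ℓ z X =
      (1 / 2 : ℝ) • sharp ℓ z (vertPart (thirdDeriv ℓ z (X, 0) (0, z.2))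
        + vertPart (thirdDeriv ℓ z (z.2, 0) (0, X)) - horizPart (thirdDeriv ℓ z (0, X) (0, z.2))
        - vertPart (thirdDeriv ℓ z (0, sprayVector ℓ z) (0, X))) := rfl

theorem chernMap_apply (ℓ : E → E → ℝ) (z : E × E) (X Y : E) :
    chernMap ℓ z X Y = (1 / 2 : ℝ) • sharp ℓ z
        (vertPart (thirdDeriv ℓ z (X, 0) (0, Y)) + vertPart (thirdDeriv ℓ z (Y, 0) (0, X))
        - horizPart (thirdDeriv ℓ z (0, X) (0, Y))
        - vertPart (thirdDeriv ℓ z (0, nonlinearConnection ℓ z X) (0, Y))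
        - vertPart (thirdDeriv ℓ z (0, nonlinearConnection ℓ z Y) (0, X))
        + vertPart (thirdDeriv ℓ z (0, X) (0, Y)) ∘L nonlinearConnection ℓ z) := rfl

namespace IsLocalPseudoFinsler

variable {ℓ : E → E → ℝ} {U : Set (E × E)} (h : IsLocalPseudoFinsler ℓ U)
include h

/-- Nondegeneracy gives injectivity, and `E` and its dual have the same finite dimension. -/
theorem isInvertible_vertHessian {z : E × E} (hz : z ∈ U) : (vertHessian ℓ z).IsInvertible := by
  have hinj : Function.Injective (vertHessian ℓ z : E →ₗ[ℝ] E →L[ℝ] ℝ) := by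
    rw [← LinearMap.ker_eq_bot, LinearMap.ker_eq_bot']
    intro u hu
    refine h.eq_zero_of_secondDeriv hz fun w => ?_
    exact congrArg (fun φ : E →L[ℝ] ℝ => φ w) hu
  have hdim : Module.finrank ℝ E = Module.finrank ℝ (E →L[ℝ] ℝ) := by
    rw [← (LinearMap.toContinuousLinearMap (𝕜 := ℝ) (E := E) (F' := ℝ)).finrank_eq]
    exact (Subspace.dual_finrank_eq).symm
  refine ⟨(LinearEquiv.ofInjectiveOfFinrankEq _ hinj hdim).toContinuousLinearEquiv, ?_⟩
  ext u w
  rfl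

theorem secondDeriv_sharp {z : E × E} (hz : z ∈ U) (φ : E →L[ℝ] ℝ) (w : E) :
    secondDeriv ℓ z (0, sharp ℓ z φ) (0, w) = φ w :=
  congrArg (fun φ : E →L[ℝ] ℝ => φ w) ((h.isInvertible_vertHessian hz).self_apply_inverse φ)

theorem secondDeriv_sprayVector {z : E × E} (hz : z ∈ U) (w : E) :
    secondDeriv ℓ z (0, sprayVector ℓ z) (0, w) = thirdDeriv ℓ z (z.2, 0) (0, z.2) (0, w)
      - 1 / 2 * thirdDeriv ℓ z (0, z.2) (0, z.2) (w, 0) := by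
  rw [sprayVector, h.secondDeriv_sharp hz]
  simp

theorem secondDeriv_nonlinearConnection {z : E × E} (hz : z ∈ U) (X w : E) :
    secondDeriv ℓ z (0, nonlinearConnection ℓ z X) (0, w) = 1 / 2 *
      (thirdDeriv ℓ z (X, 0) (0, z.2) (0, w) + thirdDeriv ℓ z (z.2, 0) (0, X) (0, w)
        - thirdDeriv ℓ z (0, X) (0, z.2) (w, 0)
        - thirdDeriv ℓ z (0, sprayVector ℓ z) (0, X) (0, w)) := by
  rw [nonlinearConnection_apply, mk_zero_smul, map_smul, smul_apply,
    h.secondDeriv_sharp hz]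
  simp

theorem secondDeriv_chernMap {z : E × E} (hz : z ∈ U) (X Y w : E) :
    secondDeriv ℓ z (0, chernMap ℓ z X Y) (0, w) = 1 / 2 *
      (thirdDeriv ℓ z (X, 0) (0, Y) (0, w) + thirdDeriv ℓ z (Y, 0) (0, X) (0, w)
        - thirdDeriv ℓ z (0, X) (0, Y) (w, 0)
        - thirdDeriv ℓ z (0, nonlinearConnection ℓ z X) (0, Y) (0, w)
        - thirdDeriv ℓ z (0, nonlinearConnection ℓ z Y) (0, X) (0, w)
        + thirdDeriv ℓ z (0, X) (0, Y) (0, nonlinearConnection ℓ z w)) := by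
  rw [chernMap_apply, mk_zero_smul, map_smul, smul_apply,
    h.secondDeriv_sharp hz]
  simp

omit [FiniteDimensional ℝ E] in
theorem eq_of_secondDeriv {z : E × E} (hz : z ∈ U) {u v : E}
    (huv : ∀ w, secondDeriv ℓ z (0, u) (0, w) = secondDeriv ℓ z (0, v) (0, w)) : u = v := by
  rw [← sub_eq_zero]
  refine h.eq_zero_of_secondDeriv hz fun w => ?_
  have : ((0 : E), u - v) = (0, u) - (0, v) := by simp
  rw [this, map_sub, sub_apply, huv, sub_self]

/-- The cyclic Koszul combination of the metric identity determines `Γ(X, Y)` up to Cartan terms in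
`Γ(·, y)`. Putting `Y = y` leaves only the term in `Γ(y, y)`, and putting `X = Y = y` removes that
too. This is the origin of `sprayVector`, `nonlinearConnection` and `chernMap`; the proof checks
that these three levels are consistent and then recovers the metric identity. -/
theorem isChernSymbol_chernMap {z : E × E} (hz : z ∈ U) :
    IsChernSymbol ℓ z.1 z.2 (fun X Y => chernMap ℓ z X Y) := by
  have c1 := h.thirdDeriv_comm_left hz
  have c2 := h.thirdDeriv_comm_right hz
  have hT : ∀ u v, thirdDeriv ℓ z (0, u) (0, v) (0, z.2) = 0 := h.thirdDeriv_vert_snd hz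
  have hT' : ∀ u v, thirdDeriv ℓ z (0, u) (0, z.2) (0, v) = 0 := fun u v => by rw [c2, hT]
  have hs : ∀ X Y, chernMap ℓ z X Y = chernMap ℓ z Y X := fun X Y =>
    h.eq_of_secondDeriv hz fun w => by
      rw [h.secondDeriv_chernMap hz, h.secondDeriv_chernMap hz, c1 (0, X) (0, Y) (w, 0),
        c1 (0, X) (0, Y)]
      ring
  have hspray : nonlinearConnection ℓ z z.2 = sprayVector ℓ z :=
    h.eq_of_secondDeriv hz fun w => by
      rw [h.secondDeriv_nonlinearConnection hz, h.secondDeriv_sprayVector hz, hT']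
      ring
  have hnl : ∀ X, chernMap ℓ z X z.2 = nonlinearConnection ℓ z X := fun X =>
    h.eq_of_secondDeriv hz fun w => by
      rw [h.secondDeriv_chernMap hz, h.secondDeriv_nonlinearConnection hz, hspray, hT', hT']
      ring
  refine (h.isChernSymbol_iff hz _).2 ⟨hs, fun X Y Z => ?_⟩
  rw [hnl, h.secondDeriv_comm hz (0, Y), h.secondDeriv_chernMap hz, h.secondDeriv_chernMap hz,
    c2 (0, X) (0, Y) (Z, 0), c1 (0, X) (Z, 0), c2 (0, X) (0, Z) (Y, 0), c1 (0, X) (Y, 0),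
    c2 (X, 0) (0, Z),
    c2 (0, X) (0, Y), c1 (0, X) (0, nonlinearConnection ℓ z Z),
    c2 (0, X) (0, Z), c1 (0, X) (0, nonlinearConnection ℓ z Y),
    c2 (0, nonlinearConnection ℓ z X) (0, Z)]
  ring

theorem chernSymbol_eq_chernMap {z : E × E} (hz : z ∈ U) :
    chernSymbol ℓ z.1 z.2 = fun X Y => chernMap ℓ z X Y :=
  h.chernSymbol_eq hz (h.isChernSymbol_chernMap hz)

theorem chernMap_comm {z : E × E} (hz : z ∈ U) (X Y : E) :
    chernMap ℓ z X Y = chernMap ℓ z Y X :=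
  ((h.isChernSymbol_iff hz _).1 (h.isChernSymbol_chernMap hz)).1 X Y

theorem thirdDeriv_eq_chernMap {z : E × E} (hz : z ∈ U) (X Y Z : E) :
    thirdDeriv ℓ z (X, 0) (0, Y) (0, Z) = secondDeriv ℓ z (0, chernMap ℓ z X Y) (0, Z)
      + secondDeriv ℓ z (0, Y) (0, chernMap ℓ z X Z)
      + thirdDeriv ℓ z (0, chernMap ℓ z X z.2) (0, Y) (0, Z) :=
  ((h.isChernSymbol_iff hz _).1 (h.isChernSymbol_chernMap hz)).2 X Y Z

/-- Operator inversion is smooth at invertible maps, and `E` is complete because it is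
finite-dimensional. -/
theorem contDiffOn_sharp : ContDiffOn ℝ ∞ (sharp ℓ) U := by
  have := FiniteDimensional.complete ℝ E
  have h1 : ContDiffOn ℝ ∞ (vertHessian ℓ) U := by
    rw [contDiffOn_clm_apply]
    intro u
    rw [contDiffOn_clm_apply]
    intro w
    exact (h.contDiffOn_secondDeriv.clm_apply contDiffOn_const).clm_apply contDiffOn_const
  intro z hz
  exact ((h.isInvertible_vertHessian hz).contDiffAt_map_inverse).comp_contDiffWithinAt z (h1 z hz)

theorem contDiffOn_sprayVector : ContDiffOn ℝ ∞ (sprayVector ℓ) U := by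
  have h3 := h.contDiffOn_thirdDeriv
  have hs := h.contDiffOn_sharp
  unfold sprayVector
  refine hs.clm_apply ?_
  have hv : ContDiffOn ℝ ∞ (fun z : E × E => (z.2, (0 : E))) U := by fun_prop
  have hw : ContDiffOn ℝ ∞ (fun z : E × E => ((0 : E), z.2)) U := by fun_prop
  exact (contDiffOn_const.clm_apply ((h3.clm_apply hv).clm_apply hw)).sub
    ((contDiffOn_const.clm_apply ((h3.clm_apply hw).clm_apply hw)).const_smul (1 / 2 : ℝ))

theorem contDiffOn_nonlinearConnection : ContDiffOn ℝ ∞ (nonlinearConnection ℓ) U := by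
  have h3 := h.contDiffOn_thirdDeriv
  have hs := h.contDiffOn_sharp
  have hP := h.contDiffOn_sprayVector
  rw [contDiffOn_clm_apply]
  intro X
  simp only [nonlinearConnection_apply]
  refine ContDiffOn.const_smul (1 / 2 : ℝ) (hs.clm_apply ?_)
  have hv : ContDiffOn ℝ ∞ (fun z : E × E => (z.2, (0 : E))) U := by fun_prop
  have hw : ContDiffOn ℝ ∞ (fun z : E × E => ((0 : E), z.2)) U := by fun_prop
  have hp : ContDiffOn ℝ ∞ (fun z : E × E => ((0 : E), sprayVector ℓ z)) U := by fun_prop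
  exact (((contDiffOn_const.clm_apply ((h3.clm_apply contDiffOn_const).clm_apply hw)).add
    (contDiffOn_const.clm_apply ((h3.clm_apply hv).clm_apply contDiffOn_const))).sub
    (contDiffOn_const.clm_apply ((h3.clm_apply contDiffOn_const).clm_apply hw))).sub
    (contDiffOn_const.clm_apply ((h3.clm_apply hp).clm_apply contDiffOn_const))

theorem contDiffOn_chernMap : ContDiffOn ℝ ∞ (chernMap ℓ) U := by
  have h3 := h.contDiffOn_thirdDeriv
  have hs := h.contDiffOn_sharp
  have hN := h.contDiffOn_nonlinearConnection
  rw [contDiffOn_clm_apply]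
  intro X
  rw [contDiffOn_clm_apply]
  intro Y
  simp only [chernMap_apply]
  refine ContDiffOn.const_smul (1 / 2 : ℝ) (hs.clm_apply ?_)
  have hn : ∀ X, ContDiffOn ℝ ∞ (fun z : E × E => ((0 : E), nonlinearConnection ℓ z X)) U :=
    fun X => contDiffOn_const.prodMk (hN.clm_apply contDiffOn_const)
  have hc : ∀ a b, ContDiffOn ℝ ∞ (fun z : E × E => thirdDeriv ℓ z a b) U :=
    fun a b => (h3.clm_apply contDiffOn_const).clm_apply contDiffOn_const
  have hd : ∀ X Y, ContDiffOn ℝ ∞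
      (fun z : E × E => thirdDeriv ℓ z (0, nonlinearConnection ℓ z X) (0, Y)) U :=
    fun X Y => (h3.clm_apply (hn X)).clm_apply contDiffOn_const
  exact (((((contDiffOn_const.clm_apply (hc _ _)).add (contDiffOn_const.clm_apply (hc _ _))).sub
    (contDiffOn_const.clm_apply (hc _ _))).sub (contDiffOn_const.clm_apply (hd _ _))).sub
    (contDiffOn_const.clm_apply (hd _ _))).add
    ((contDiffOn_const.clm_apply (hc _ _)).clm_comp hN)

end IsLocalPseudoFinsler
end LocalChern

/-! ### Behaviour under a change of coordinates. -/

section ChartChange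

variable {E : Type*} [NormedAddCommGroup E] [NormedSpace ℝ E]

/-- `ψ` is a change of coordinates on the open set `O` that transforms `ℓ` into `ℓ'`. -/
structure IsCoordinateChange (ℓ ℓ' : E → E → ℝ) (O : Set E) (ψ : E → E) : Prop where
  isOpen : IsOpen O
  smooth : ContDiffOn ℝ ∞ ψ O
  injective : ∀ x ∈ O, Function.Injective (fderiv ℝ ψ x)
  eq : ∀ x ∈ O, ∀ y, ℓ x y = ℓ' (ψ x) (fderiv ℝ ψ x y)

namespace IsCoordinateChange

variable {ℓ ℓ' : E → E → ℝ} {O : Set E} {ψ : E → E} (hψ : IsCoordinateChange ℓ ℓ' O ψ)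
include hψ

theorem contDiffOn_fderiv : ContDiffOn ℝ ∞ (fderiv ℝ ψ) O :=
  hψ.smooth.fderiv_of_isOpen hψ.isOpen (by simp)

theorem hasFDerivAt {x : E} (hx : x ∈ O) : HasFDerivAt ψ (fderiv ℝ ψ x) x :=
  ((hψ.smooth.contDiffAt (hψ.isOpen.mem_nhds hx)).differentiableAt (by simp)).hasFDerivAt

theorem hasFDerivAt_fderiv {x : E} (hx : x ∈ O) :
    HasFDerivAt (fderiv ℝ ψ) (fderiv ℝ (fderiv ℝ ψ) x) x :=
  ((hψ.contDiffOn_fderiv.contDiffAt (hψ.isOpen.mem_nhds hx)).differentiableAt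
    (by simp)).hasFDerivAt

theorem secondFDeriv_comm {x : E} (hx : x ∈ O) (X Y : E) :
    fderiv ℝ (fderiv ℝ ψ) x X Y = fderiv ℝ (fderiv ℝ ψ) x Y X :=
  ((hψ.smooth.contDiffAt (hψ.isOpen.mem_nhds hx)).isSymmSndFDerivAt
    (by simp; exact WithTop.coe_le_coe.2 (le_top (a := (2 : ℕ∞))))).eq X Y

theorem fibreHessian_eq {x : E} (hx : x ∈ O) (y u w : E) :
    fibreHessian (ℓ x) y u w = fibreHessian (ℓ' (ψ x)) (fderiv ℝ ψ x y)
      (fderiv ℝ ψ x u) (fderiv ℝ ψ x w) := by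
  simp only [fibreHessian, hψ.eq x hx, map_add, map_smul]

variable {U U' : Set (E × E)} (h : IsLocalPseudoFinsler ℓ U) (h' : IsLocalPseudoFinsler ℓ' U')
include h h'

theorem secondDeriv_eq {z : E × E} (hx : z.1 ∈ O) (hz : z ∈ U)
    (hz' : (ψ z.1, fderiv ℝ ψ z.1 z.2) ∈ U') (u w : E) :
    secondDeriv ℓ z (0, u) (0, w) = secondDeriv ℓ' (ψ z.1, fderiv ℝ ψ z.1 z.2)
      (0, fderiv ℝ ψ z.1 u) (0, fderiv ℝ ψ z.1 w) := by
  have h1 := hψ.fibreHessian_eq hx z.2 u w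
  rw [h.fibreHessian_eq hz, h'.fibreHessian_eq hz'] at h1
  linarith

/-- This is `secondDeriv_eq` differentiated along the line through `z` in the direction `(X, v)`.
The second derivative of `ψ` appears three times: through the transformed reference vector and
through each of the two vertical arguments. -/
theorem thirdDeriv_eq {z : E × E} (hx : z.1 ∈ O) (hz : z ∈ U)
    (hz' : (ψ z.1, fderiv ℝ ψ z.1 z.2) ∈ U') (X v u w : E) :
    thirdDeriv ℓ z (X, v) (0, u) (0, w) =
      thirdDeriv ℓ' (ψ z.1, fderiv ℝ ψ z.1 z.2)
        (fderiv ℝ ψ z.1 X, fderiv ℝ (fderiv ℝ ψ) z.1 X z.2 + fderiv ℝ ψ z.1 v)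
        (0, fderiv ℝ ψ z.1 u) (0, fderiv ℝ ψ z.1 w)
      + secondDeriv ℓ' (ψ z.1, fderiv ℝ ψ z.1 z.2)
        (0, fderiv ℝ (fderiv ℝ ψ) z.1 X u) (0, fderiv ℝ ψ z.1 w)
      + secondDeriv ℓ' (ψ z.1, fderiv ℝ ψ z.1 z.2)
        (0, fderiv ℝ ψ z.1 u) (0, fderiv ℝ (fderiv ℝ ψ) z.1 X w) := by
  have hfst : HasDerivAt (fun t : ℝ => (z + t • (X, v)).1) X 0 := by
    have : HasDerivAt (fun t : ℝ => z.1 + t • X) ((1 : ℝ) • X) 0 :=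
      ((hasDerivAt_id (0 : ℝ)).smul_const X).const_add z.1
    simpa using this
  have hsnd : HasDerivAt (fun t : ℝ => (z + t • (X, v)).2) v 0 := by
    have : HasDerivAt (fun t : ℝ => z.2 + t • v) ((1 : ℝ) • v) 0 :=
      ((hasDerivAt_id (0 : ℝ)).smul_const v).const_add z.2
    simpa using this
  have hline : HasDerivAt (fun t : ℝ => z + t • (X, v)) (X, v) 0 := hfst.prodMk hsnd
  have e0 : z + (0 : ℝ) • (X, v) = z := by simp
  have e1 : (z + (0 : ℝ) • (X, v)).1 = z.1 := by simp
  have e2 : (z + (0 : ℝ) • (X, v)).2 = z.2 := by simp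
  have hψ1 : HasDerivAt (fun t : ℝ => ψ (z + t • (X, v)).1) (fderiv ℝ ψ z.1 X) 0 :=
    HasFDerivAt.comp_hasDerivAt (0 : ℝ) (by rw [e1]; exact hψ.hasFDerivAt hx) hfst
  have hψ2 : HasDerivAt (fun t : ℝ => fderiv ℝ ψ (z + t • (X, v)).1)
      (fderiv ℝ (fderiv ℝ ψ) z.1 X) 0 :=
    HasFDerivAt.comp_hasDerivAt (0 : ℝ) (by rw [e1]; exact hψ.hasFDerivAt_fderiv hx) hfst
  have hc : ∀ a : E, HasDerivAt (fun t : ℝ => ((0 : E), fderiv ℝ ψ (z + t • (X, v)).1 a))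
      ((0 : E), fderiv ℝ (fderiv ℝ ψ) z.1 X a) 0 := fun a =>
    (hasDerivAt_const _ _).prodMk ((hψ2.clm_apply (hasDerivAt_const _ a)).congr_deriv (by simp))
  have hΨ : HasDerivAt (fun t : ℝ => (ψ (z + t • (X, v)).1,
      fderiv ℝ ψ (z + t • (X, v)).1 (z + t • (X, v)).2))
      (fderiv ℝ ψ z.1 X, fderiv ℝ (fderiv ℝ ψ) z.1 X z.2 + fderiv ℝ ψ z.1 v) 0 := by
    refine hψ1.prodMk ((hψ2.clm_apply hsnd).congr_deriv ?_)
    rw [e1, e2]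
  have hD : HasDerivAt (fun t : ℝ => secondDeriv ℓ' (ψ (z + t • (X, v)).1,
      fderiv ℝ ψ (z + t • (X, v)).1 (z + t • (X, v)).2)) _ 0 :=
    HasFDerivAt.comp_hasDerivAt (0 : ℝ) (by rw [e0]; exact h'.hasFDerivAt_secondDeriv hz') hΨ
  have hR := (hD.clm_apply (hc u)).clm_apply (hc w)
  have hL := h.hasLineDerivAt_secondDeriv hz (X, v) (0, u) (0, w)
  have hev : ∀ᶠ t : ℝ in nhds 0, secondDeriv ℓ (z + t • (X, v)) (0, u) (0, w) =
      secondDeriv ℓ' (ψ (z + t • (X, v)).1, fderiv ℝ ψ (z + t • (X, v)).1 (z + t • (X, v)).2)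
        (0, fderiv ℝ ψ (z + t • (X, v)).1 u) (0, fderiv ℝ ψ (z + t • (X, v)).1 w) := by
    filter_upwards [hline.continuousAt.eventually_mem (h.isOpen.mem_nhds (by rwa [e0])),
      hfst.continuousAt.eventually_mem (hψ.isOpen.mem_nhds (by rwa [e1])),
      hΨ.continuousAt.eventually_mem (h'.isOpen.mem_nhds (by rwa [e0]))] with t h1 h2 h3
    exact hψ.secondDeriv_eq h h' h2 h1 h3 u w
  rw [hL.unique (hR.congr_of_eventuallyEq hev)]
  simp only [e1, e2, add_apply]

variable [FiniteDimensional ℝ E]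

/-- By uniqueness it suffices that the pulled-back symbol satisfies the two defining conditions for
`ℓ`. The three second-derivative terms of `thirdDeriv_eq` are exactly those produced by the
inhomogeneous part of the transformation law. -/
theorem chernMap_eq {z : E × E} (hx : z.1 ∈ O) (hz : z ∈ U)
    (hz' : (ψ z.1, fderiv ℝ ψ z.1 z.2) ∈ U') (X Y : E) :
    fderiv ℝ ψ z.1 (chernMap ℓ z X Y) =
      fderiv ℝ (fderiv ℝ ψ) z.1 X Y + chernMap ℓ' (ψ z.1, fderiv ℝ ψ z.1 z.2)
        (fderiv ℝ ψ z.1 X) (fderiv ℝ ψ z.1 Y) := by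
  have hsurj : Function.Surjective (fderiv ℝ ψ z.1) :=
    LinearMap.surjective_of_injective (f := (fderiv ℝ ψ z.1 : E →ₗ[ℝ] E)) (hψ.injective _ hx)
  choose inv hinv using hsurj
  set z' : E × E := (ψ z.1, fderiv ℝ ψ z.1 z.2) with hzdef
  have key : IsChernSymbol ℓ z.1 z.2 (fun X Y => inv (fderiv ℝ (fderiv ℝ ψ) z.1 X Y
      + chernMap ℓ' z' (fderiv ℝ ψ z.1 X) (fderiv ℝ ψ z.1 Y))) := by
    refine (h.isChernSymbol_iff hz _).2 ⟨fun X Y => ?_, fun X Y Z => ?_⟩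
    · rw [hψ.secondFDeriv_comm hx, h'.chernMap_comm hz']
    · have h3 := hψ.thirdDeriv_eq h h' hx hz hz' 0 (inv (fderiv ℝ (fderiv ℝ ψ) z.1 X z.2
        + chernMap ℓ' z' (fderiv ℝ ψ z.1 X) (fderiv ℝ ψ z.1 z.2))) Y Z
      have h0 : ((0 : E), (0 : E)) = 0 := rfl
      have hch := h'.thirdDeriv_eq_chernMap hz' (fderiv ℝ ψ z.1 X) (fderiv ℝ ψ z.1 Y)
        (fderiv ℝ ψ z.1 Z)
      have hsplit : (fderiv ℝ ψ z.1 X, fderiv ℝ (fderiv ℝ ψ) z.1 X z.2) =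
        (fderiv ℝ ψ z.1 X, 0) + (0, fderiv ℝ (fderiv ℝ ψ) z.1 X z.2) := by simp
      rw [h3, hψ.secondDeriv_eq h h' hx hz hz', hψ.secondDeriv_eq h h' hx hz hz',
        hψ.thirdDeriv_eq h h' hx hz hz']
      simp only [hinv, map_zero, zero_apply, zero_add, add_zero, h0, ← hzdef, hsplit, mk_zero_add,
        map_add, add_apply, hch]
      ring
  have := h.isChernSymbol_unique hz (h.isChernSymbol_chernMap hz) key
  rw [congrFun (congrFun this X) Y, hinv]

end IsCoordinateChange
end ChartChange

/-! ### Partial derivatives on boxes that may contain boundary points. -/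

section Partial

variable {F : Type*} [NormedAddCommGroup F] [NormedSpace ℝ F]

/-- The partial derivative with respect to the first variable, within `K`. -/
def partialFst (K : Set (ℝ × ℝ)) (f : ℝ × ℝ → F) (z : ℝ × ℝ) : F := fderivWithin ℝ f K z (1, 0)

/-- The partial derivative with respect to the second variable, within `K`. -/
def partialSnd (K : Set (ℝ × ℝ)) (f : ℝ × ℝ → F) (z : ℝ × ℝ) : F := fderivWithin ℝ f K z (0, 1)

/-- A product of two sets of reals that have unique derivatives and lie in the closure of their
interior. -/
structure IsBox (T I : Set ℝ) : Prop where
  fst : UniqueDiffOn ℝ T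
  snd : UniqueDiffOn ℝ I
  subset_fst : T ⊆ closure (interior T)
  subset_snd : I ⊆ closure (interior I)

namespace IsBox

variable {T I : Set ℝ} (hK : IsBox T I) {f g : ℝ × ℝ → F} {t s : ℝ}
include hK

theorem uniqueDiffOn : UniqueDiffOn ℝ (T ×ˢ I) := hK.fst.prod hK.snd

theorem contDiffOn_partialFst (hf : ContDiffOn ℝ ∞ f (T ×ˢ I)) :
    ContDiffOn ℝ ∞ (partialFst (T ×ˢ I) f) (T ×ˢ I) :=
  (hf.fderivWithin hK.uniqueDiffOn (by simp)).clm_apply contDiffOn_const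

theorem contDiffOn_partialSnd (hf : ContDiffOn ℝ ∞ f (T ×ˢ I)) :
    ContDiffOn ℝ ∞ (partialSnd (T ×ˢ I) f) (T ×ˢ I) :=
  (hf.fderivWithin hK.uniqueDiffOn (by simp)).clm_apply contDiffOn_const

/-- At boundary points, such as the ends of a closed interval, symmetry of the second derivative
within the box follows because the point is a limit of interior points; the closure conditions in
`IsBox` serve this purpose. -/
theorem comm (hf : ContDiffOn ℝ ∞ f (T ×ˢ I)) {z : ℝ × ℝ} (hz : z ∈ T ×ˢ I) :
    partialSnd (T ×ˢ I) (partialFst (T ×ˢ I) f) z =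
      partialFst (T ×ˢ I) (partialSnd (T ×ˢ I) f) z := by
  have h1 : DifferentiableWithinAt ℝ (fderivWithin ℝ f (T ×ˢ I)) (T ×ˢ I) z :=
    (hf.fderivWithin hK.uniqueDiffOn (m := ∞) (by simp)).differentiableOn (by simp) z hz
  have h2 : ∀ a b : ℝ × ℝ, fderivWithin ℝ (fun z => fderivWithin ℝ f (T ×ˢ I) z a) (T ×ˢ I) z b =
      fderivWithin ℝ (fderivWithin ℝ f (T ×ˢ I)) (T ×ˢ I) z b a := fun a b => by
    rw [fderivWithin_clm_apply (hK.uniqueDiffOn z hz) h1 (differentiableWithinAt_const a)]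
    simp
  have hsub : z ∈ closure (interior (T ×ˢ I)) := by
    rw [interior_prod_eq, closure_prod_eq]
    exact ⟨hK.subset_fst hz.1, hK.subset_snd hz.2⟩
  have h3 := (hf z hz).isSymmSndFDerivWithinAt
    (by simp; exact WithTop.coe_le_coe.2 (le_top (a := (2 : ℕ∞)))) hK.uniqueDiffOn hsub hz
  exact (h2 _ _).trans ((h3.eq _ _).trans (h2 _ _).symm)

omit hK in
theorem _root_.DifferentiableWithinAt.hasDerivWithinAt_partialFst
    (hf : DifferentiableWithinAt ℝ f (T ×ˢ I) (t, s)) (hs : s ∈ I) :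
    HasDerivWithinAt (fun τ => f (τ, s)) (partialFst (T ×ˢ I) f (t, s)) T t := by
  refine HasFDerivWithinAt.comp_hasDerivWithinAt t (t := T ×ˢ I) hf.hasFDerivWithinAt
    ((hasDerivWithinAt_id t T).prodMk (hasDerivWithinAt_const t T s)) fun τ hτ => ⟨hτ, hs⟩

omit hK in
theorem _root_.DifferentiableWithinAt.hasDerivWithinAt_partialSnd
    (hf : DifferentiableWithinAt ℝ f (T ×ˢ I) (t, s)) (ht : t ∈ T) :
    HasDerivWithinAt (fun σ => f (t, σ)) (partialSnd (T ×ˢ I) f (t, s)) I s := by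
  refine HasFDerivWithinAt.comp_hasDerivWithinAt s (t := T ×ˢ I) hf.hasFDerivWithinAt
    ((hasDerivWithinAt_const s I t).prodMk (hasDerivWithinAt_id s I)) fun τ hτ => ⟨ht, hτ⟩

theorem partialFst_eq (hf : ContDiffOn ℝ ∞ f (T ×ˢ I)) (ht : t ∈ T) (hs : s ∈ I) {f' : F}
    (h : HasDerivWithinAt (fun τ => f (τ, s)) f' T t) : partialFst (T ×ˢ I) f (t, s) = f' :=
  (hK.fst t ht).eq_deriv _ ((hf.differentiableOn (by simp) _
    ⟨ht, hs⟩).hasDerivWithinAt_partialFst hs) h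

theorem partialSnd_eq (hf : ContDiffOn ℝ ∞ f (T ×ˢ I)) (ht : t ∈ T) (hs : s ∈ I) {f' : F}
    (h : HasDerivWithinAt (fun σ => f (t, σ)) f' I s) : partialSnd (T ×ˢ I) f (t, s) = f' :=
  (hK.snd s hs).eq_deriv _ ((hf.differentiableOn (by simp) _
    ⟨ht, hs⟩).hasDerivWithinAt_partialSnd ht) h

set_option linter.unusedSectionVars false in
theorem hasDerivWithinAt_fst (hf : ContDiffOn ℝ ∞ f (T ×ˢ I)) {z : ℝ × ℝ} (hz : z ∈ T ×ˢ I) :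
    HasDerivWithinAt (fun τ => f (τ, z.2)) (partialFst (T ×ˢ I) f z) T z.1 :=
  (hf.differentiableOn (by simp) z hz).hasDerivWithinAt_partialFst hz.2

set_option linter.unusedSectionVars false in
theorem hasDerivWithinAt_snd (hf : ContDiffOn ℝ ∞ f (T ×ˢ I)) {z : ℝ × ℝ} (hz : z ∈ T ×ˢ I) :
    HasDerivWithinAt (fun σ => f (z.1, σ)) (partialSnd (T ×ˢ I) f z) I z.2 :=
  (hf.differentiableOn (by simp) z hz).hasDerivWithinAt_partialSnd hz.1

end IsBox
end Partial

/-! ### The Jacobi equation in a chart as the linearized Euler-Lagrange equation. -/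

section LocalJacobi

variable {E : Type*} [NormedAddCommGroup E] [NormedSpace ℝ E] [FiniteDimensional ℝ E]

namespace IsLocalPseudoFinsler

variable {ℓ : E → E → ℝ} {U : Set (E × E)} (h : IsLocalPseudoFinsler ℓ U)
include h

/-- The metric identity with `Y` equal to the reference vector: Euler's relation lowers the left
side to a second derivative and kills the Cartan term. -/
theorem secondDeriv_chernMap_snd {z : E × E} (hz : z ∈ U) (X a : E) :
    secondDeriv ℓ z (X, 0) (0, a) = secondDeriv ℓ z (0, chernMap ℓ z X z.2) (0, a)
      + secondDeriv ℓ z (0, z.2) (0, chernMap ℓ z X a) := by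
  have h1 := h.thirdDeriv_eq_chernMap hz X z.2 a
  rwa [h.thirdDeriv_comm_right hz, h.thirdDeriv_horiz_snd hz, h.thirdDeriv_comm_right hz (0, _),
    h.thirdDeriv_vert_snd hz, add_zero] at h1

/-- This says that the geodesic spray is the Euler-Lagrange spray of `ℓ`. It combines the previous
identity for `(y, a)` with the one for `(a, y)`, whose left side is `2 * firstDeriv ℓ z (a, 0)` by
homogeneity. -/
theorem secondDeriv_chernMap_snd_snd {z : E × E} (hz : z ∈ U) (a : E) :
    secondDeriv ℓ z (0, chernMap ℓ z z.2 z.2) (0, a) =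
      secondDeriv ℓ z (z.2, 0) (0, a) - firstDeriv ℓ z (a, 0) := by
  have h1 := h.secondDeriv_chernMap_snd hz z.2 a
  have h2 := h.secondDeriv_chernMap_snd hz a z.2
  rw [h.secondDeriv_horiz_snd hz, h.secondDeriv_comm hz _ (0, z.2),
    h.chernMap_comm hz a z.2] at h2
  linarith

/-- The expression of the Lagrange form of two fields `J₁, J₂` with derivatives `K₁, K₂` by the
canonical symplectic form. -/
theorem secondDeriv_skew {z : E × E} (hz : z ∈ U) (J₁ K₁ J₂ K₂ : E) :
    secondDeriv ℓ z (0, J₁) (0, K₂ + chernMap ℓ z J₂ z.2)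
      - secondDeriv ℓ z (0, K₁ + chernMap ℓ z J₁ z.2) (0, J₂) =
    secondDeriv ℓ z (J₂, K₂) (0, J₁) - secondDeriv ℓ z (J₁, K₁) (0, J₂) := by
  have h1 := h.secondDeriv_chernMap_snd hz J₁ J₂
  have h2 := h.secondDeriv_chernMap_snd hz J₂ J₁
  have e : ∀ a b : E, (a, b) = (a, 0) + (0, b) := fun a b => by simp
  -- By symmetry of the symbol, `h1` and `h2` share the term pairing `z.2` with `Γ(J₁, J₂)`, which
  -- cancels in their difference.
  rw [h.chernMap_comm hz J₂ J₁] at h2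
  rw [h.secondDeriv_comm hz (0, J₁), e J₂, e J₁]
  simp only [mk_zero_add, map_add, add_apply]
  linarith

section Variation

variable {T I : Set ℝ} {x Z : ℝ × ℝ → E}

/-- The longitudinal covariant derivative along a variation `x`, in a chart. -/
def _root_.longDerivLocal (ℓ : E → E → ℝ) (K : Set (ℝ × ℝ)) (x V : ℝ × ℝ → E) (z : ℝ × ℝ) : E :=
  partialFst K V z + chernMap ℓ (x z, partialFst K x z) (V z) (partialFst K x z)

/-- The transverse covariant derivative along a variation `x`, in a chart. -/
def _root_.transDerivLocal (ℓ : E → E → ℝ) (K : Set (ℝ × ℝ)) (x V : ℝ × ℝ → E) (z : ℝ × ℝ) : E :=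
  partialSnd K V z + chernMap ℓ (x z, partialFst K x z) (V z) (partialSnd K x z)

variable (hK : IsBox T I) (hx : ContDiffOn ℝ ∞ x (T ×ˢ I))
  (hU : ∀ z ∈ T ×ˢ I, (x z, partialFst (T ×ˢ I) x z) ∈ U)
include hK hx hU

theorem contDiffOn_chernMap_comp :
    ContDiffOn ℝ ∞ (fun z => chernMap ℓ (x z, partialFst (T ×ˢ I) x z)) (T ×ˢ I) :=
  h.contDiffOn_chernMap.comp (hx.prodMk (hK.contDiffOn_partialFst hx)) hU

theorem contDiffOn_longDerivLocal {V : ℝ × ℝ → E} (hV : ContDiffOn ℝ ∞ V (T ×ˢ I)) :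
    ContDiffOn ℝ ∞ (longDerivLocal ℓ (T ×ˢ I) x V) (T ×ˢ I) :=
  (hK.contDiffOn_partialFst hV).add (((h.contDiffOn_chernMap_comp hK hx hU).clm_apply hV).clm_apply
    (hK.contDiffOn_partialFst hx))

theorem contDiffOn_transDerivLocal {V : ℝ × ℝ → E} (hV : ContDiffOn ℝ ∞ V (T ×ˢ I)) :
    ContDiffOn ℝ ∞ (transDerivLocal ℓ (T ×ˢ I) x V) (T ×ˢ I) :=
  (hK.contDiffOn_partialSnd hV).add (((h.contDiffOn_chernMap_comp hK hx hU).clm_apply hV).clm_apply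
    (hK.contDiffOn_partialSnd hx))

omit [FiniteDimensional ℝ E] h hx hU in
theorem _root_.IsBox.partialFst_sub {V W : ℝ × ℝ → E} (hV : ContDiffOn ℝ ∞ V (T ×ˢ I))
    (hW : ContDiffOn ℝ ∞ W (T ×ˢ I)) {z : ℝ × ℝ} (hz : z ∈ T ×ˢ I) :
    partialFst (T ×ˢ I) (fun z => V z - W z) z =
      partialFst (T ×ˢ I) V z - partialFst (T ×ˢ I) W z := by
  rw [partialFst, fderivWithin_fun_sub (hK.uniqueDiffOn z hz) (hV.differentiableOn (by simp) z hz)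
    (hW.differentiableOn (by simp) z hz)]
  rfl

omit [FiniteDimensional ℝ E] h hx hU in
theorem _root_.IsBox.partialSnd_sub {V W : ℝ × ℝ → E} (hV : ContDiffOn ℝ ∞ V (T ×ˢ I))
    (hW : ContDiffOn ℝ ∞ W (T ×ˢ I)) {z : ℝ × ℝ} (hz : z ∈ T ×ˢ I) :
    partialSnd (T ×ˢ I) (fun z => V z - W z) z =
      partialSnd (T ×ˢ I) V z - partialSnd (T ×ˢ I) W z := by
  rw [partialSnd, fderivWithin_fun_sub (hK.uniqueDiffOn z hz) (hV.differentiableOn (by simp) z hz)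
    (hW.differentiableOn (by simp) z hz)]
  rfl

omit [FiniteDimensional ℝ E] h hx hU hK in
theorem _root_.partialFst_congr {K : Set (ℝ × ℝ)} {V W : ℝ × ℝ → E} (hVW : EqOn V W K)
    {z : ℝ × ℝ} (hz : z ∈ K) : partialFst K V z = partialFst K W z := by
  rw [partialFst, fderivWithin_congr hVW (hVW hz)]
  rfl

omit [FiniteDimensional ℝ E] h hx hU hK in
theorem _root_.partialSnd_congr {K : Set (ℝ × ℝ)} {V W : ℝ × ℝ → E} (hVW : EqOn V W K)
    {z : ℝ × ℝ} (hz : z ∈ K) : partialSnd K V z = partialSnd K W z := by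
  rw [partialSnd, fderivWithin_congr hVW (hVW hz)]
  rfl

omit h hx hU in
theorem longDerivLocal_sub {V W : ℝ × ℝ → E} (hV : ContDiffOn ℝ ∞ V (T ×ˢ I))
    (hW : ContDiffOn ℝ ∞ W (T ×ˢ I)) {z : ℝ × ℝ} (hz : z ∈ T ×ˢ I) :
    longDerivLocal ℓ (T ×ˢ I) x (fun z => V z - W z) z =
      longDerivLocal ℓ (T ×ˢ I) x V z - longDerivLocal ℓ (T ×ˢ I) x W z := by
  simp only [longDerivLocal, hK.partialFst_sub hV hW hz, map_sub, sub_apply]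
  abel

omit h hx hU in
theorem transDerivLocal_sub {V W : ℝ × ℝ → E} (hV : ContDiffOn ℝ ∞ V (T ×ˢ I))
    (hW : ContDiffOn ℝ ∞ W (T ×ˢ I)) {z : ℝ × ℝ} (hz : z ∈ T ×ˢ I) :
    transDerivLocal ℓ (T ×ˢ I) x (fun z => V z - W z) z =
      transDerivLocal ℓ (T ×ˢ I) x V z - transDerivLocal ℓ (T ×ˢ I) x W z := by
  simp only [transDerivLocal, hK.partialSnd_sub hV hW hz, map_sub, sub_apply]
  abel

/-- Covariant derivatives commute on a field that vanishes along the central curve. -/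
theorem longDerivLocal_transDerivLocal_of_eq_zero {V : ℝ × ℝ → E}
    (hV : ContDiffOn ℝ ∞ V (T ×ˢ I)) {s : ℝ} (hs : s ∈ I) (hV0 : ∀ t ∈ T, V (t, s) = 0)
    {t : ℝ} (ht : t ∈ T) :
    longDerivLocal ℓ (T ×ˢ I) x (transDerivLocal ℓ (T ×ˢ I) x V) (t, s) =
      transDerivLocal ℓ (T ×ˢ I) x (longDerivLocal ℓ (T ×ˢ I) x V) (t, s) := by
  have hz : (t, s) ∈ T ×ˢ I := ⟨ht, hs⟩
  have hVs := hK.contDiffOn_partialSnd hV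
  have hVt := hK.contDiffOn_partialFst hV
  have e1 : ∀ τ ∈ T, transDerivLocal ℓ (T ×ˢ I) x V (τ, s) = partialSnd (T ×ˢ I) V (τ, s) :=
    fun τ hτ => by simp [transDerivLocal, hV0 τ hτ]
  have e2 : partialFst (T ×ˢ I) (transDerivLocal ℓ (T ×ˢ I) x V) (t, s) =
      partialFst (T ×ˢ I) (partialSnd (T ×ˢ I) V) (t, s) :=
    hK.partialFst_eq (h.contDiffOn_transDerivLocal hK hx hU hV) ht hs
      (((hVs.differentiableOn (by simp) _ hz).hasDerivWithinAt_partialFst hs).congr e1 (e1 t ht))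
  have e3 : partialFst (T ×ˢ I) V (t, s) = 0 :=
    hK.partialFst_eq hV ht hs ((hasDerivWithinAt_const t T 0).congr hV0 (hV0 t ht))
  have e4 : longDerivLocal ℓ (T ×ˢ I) x V (t, s) = 0 := by
    simp [longDerivLocal, hV0 t ht, e3]
  have d1 := (hV.differentiableOn (by simp) _ hz).hasDerivWithinAt_partialSnd ht
  have d2 := (hVt.differentiableOn (by simp) _ hz).hasDerivWithinAt_partialSnd ht
  have d3 := ((h.contDiffOn_chernMap_comp hK hx hU).differentiableOn
    (by simp) _ hz).hasDerivWithinAt_partialSnd ht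
  have d4 := ((hK.contDiffOn_partialFst hx).differentiableOn
    (by simp) _ hz).hasDerivWithinAt_partialSnd ht
  -- In the product rule the derivatives of the symbol and of the velocity multiply `V (t, s) = 0`,
  -- so only the term with `∂_s V` survives.
  have e5 : partialSnd (T ×ˢ I) (longDerivLocal ℓ (T ×ˢ I) x V) (t, s) =
      partialSnd (T ×ˢ I) (partialFst (T ×ˢ I) V) (t, s) +
        chernMap ℓ (x (t, s), partialFst (T ×ˢ I) x (t, s)) (partialSnd (T ×ˢ I) V (t, s))
          (partialFst (T ×ˢ I) x (t, s)) :=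
    hK.partialSnd_eq (h.contDiffOn_longDerivLocal hK hx hU hV) ht hs
      ((d2.add ((d3.clm_apply d1).clm_apply d4)).congr_deriv (by simp [hV0 t ht]))
  rw [longDerivLocal, e1 t ht, e2, transDerivLocal, e4, e5, hK.comm hV hz]
  simp

/-- The Jacobi equation for the variational field, with the curvature term computed by any
extension `Z` of the velocity, means that the geodesic equation holds to first order. -/
theorem partialSnd_longDerivLocal_eq_zero (hZ : ContDiffOn ℝ ∞ Z (T ×ˢ I)) {s : ℝ} (hs : s ∈ I)
    (hgeo : ∀ t ∈ T, longDerivLocal ℓ (T ×ˢ I) x (partialFst (T ×ˢ I) x) (t, s) = 0)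
    (hZ0 : ∀ t ∈ T, Z (t, s) = partialFst (T ×ˢ I) x (t, s)) {t : ℝ} (ht : t ∈ T)
    (hJ : longDerivLocal ℓ (T ×ˢ I) x
        (longDerivLocal ℓ (T ×ˢ I) x (partialSnd (T ×ˢ I) x)) (t, s) =
      longDerivLocal ℓ (T ×ˢ I) x (transDerivLocal ℓ (T ×ˢ I) x Z) (t, s) -
        transDerivLocal ℓ (T ×ˢ I) x (longDerivLocal ℓ (T ×ˢ I) x Z) (t, s)) :
    partialSnd (T ×ˢ I) (longDerivLocal ℓ (T ×ˢ I) x (partialFst (T ×ˢ I) x)) (t, s) = 0 := by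
  have hz : (t, s) ∈ T ×ˢ I := ⟨ht, hs⟩
  have hxt := hK.contDiffOn_partialFst hx
  set y := partialFst (T ×ˢ I) x with hy
  -- The velocity and the extension `Z` agree on the central curve, so the commutator vanishes on
  -- their difference and `Z` may be replaced by the velocity in the curvature term.
  set V : ℝ × ℝ → E := fun z => y z - Z z with hVdef
  have hV : ContDiffOn ℝ ∞ V (T ×ˢ I) := hxt.sub hZ
  have hV0 : ∀ t ∈ T, V (t, s) = 0 := fun τ hτ => by
    change y (τ, s) - Z (τ, s) = 0
    rw [hZ0 τ hτ, sub_self]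
  have hcomm := h.longDerivLocal_transDerivLocal_of_eq_zero hK hx hU hV hs hV0 ht
  -- Torsion-freeness: the transverse derivative of the velocity is the longitudinal derivative of
  -- the variational field.
  have e1 : EqOn (transDerivLocal ℓ (T ×ˢ I) x y)
      (longDerivLocal ℓ (T ×ˢ I) x (partialSnd (T ×ˢ I) x)) (T ×ˢ I) := fun z hz => by
    rw [transDerivLocal, longDerivLocal, hK.comm hx hz, h.chernMap_comm (hU z hz)]
  have e2 : EqOn (transDerivLocal ℓ (T ×ˢ I) x V) (fun z => transDerivLocal ℓ (T ×ˢ I) x y z -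
      transDerivLocal ℓ (T ×ˢ I) x Z z) (T ×ˢ I) := fun z hz => transDerivLocal_sub hK hxt hZ hz
  have e3 : EqOn (longDerivLocal ℓ (T ×ˢ I) x V) (fun z => longDerivLocal ℓ (T ×ˢ I) x y z -
      longDerivLocal ℓ (T ×ˢ I) x Z z) (T ×ˢ I) := fun z hz => longDerivLocal_sub hK hxt hZ hz
  have cl : ∀ {A B : ℝ × ℝ → E}, EqOn A B (T ×ˢ I) → longDerivLocal ℓ (T ×ˢ I) x A (t, s) =
      longDerivLocal ℓ (T ×ˢ I) x B (t, s) := fun hAB => by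
    rw [longDerivLocal, partialFst_congr hAB hz, hAB hz]; rfl
  have ct : ∀ {A B : ℝ × ℝ → E}, EqOn A B (T ×ˢ I) → transDerivLocal ℓ (T ×ˢ I) x A (t, s) =
      transDerivLocal ℓ (T ×ˢ I) x B (t, s) := fun hAB => by
    rw [transDerivLocal, partialSnd_congr hAB hz, hAB hz]; rfl
  rw [cl e2, ct e3, longDerivLocal_sub hK (h.contDiffOn_transDerivLocal hK hx hU hxt)
    (h.contDiffOn_transDerivLocal hK hx hU hZ) hz, transDerivLocal_sub hK
    (h.contDiffOn_longDerivLocal hK hx hU hxt) (h.contDiffOn_longDerivLocal hK hx hU hZ) hz,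
    cl e1, hJ, sub_sub_cancel_left, eq_comm, sub_eq_neg_self] at hcomm
  -- What remains is the transverse covariant derivative of the acceleration, which is a plain
  -- partial derivative because the acceleration vanishes on the central curve.
  rw [transDerivLocal, hgeo t ht] at hcomm
  simpa using hcomm

omit [FiniteDimensional ℝ E] in
theorem contDiffOn_firstDeriv_comp (v : E × E) :
    ContDiffOn ℝ ∞ (fun z => firstDeriv ℓ (x z, partialFst (T ×ˢ I) x z) v) (T ×ˢ I) :=
  (h.contDiffOn_firstDeriv.comp (hx.prodMk (hK.contDiffOn_partialFst hx)) hU).clm_apply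
    contDiffOn_const

omit [FiniteDimensional ℝ E] in
theorem partialFst_firstDeriv (v : E × E) {z : ℝ × ℝ} (hz : z ∈ T ×ˢ I) :
    partialFst (T ×ˢ I) (fun z => firstDeriv ℓ (x z, partialFst (T ×ˢ I) x z) v) z =
      secondDeriv ℓ (x z, partialFst (T ×ˢ I) x z)
        (partialFst (T ×ˢ I) x z, partialFst (T ×ˢ I) (partialFst (T ×ˢ I) x) z) v := by
  have d1 : HasDerivWithinAt (fun τ => firstDeriv ℓ (x (τ, z.2), partialFst (T ×ˢ I) x (τ, z.2)))
      (secondDeriv ℓ (x z, partialFst (T ×ˢ I) x z)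
        (partialFst (T ×ˢ I) x z, partialFst (T ×ˢ I) (partialFst (T ×ˢ I) x) z)) T z.1 :=
    HasFDerivAt.comp_hasDerivWithinAt z.1 (h.hasFDerivAt_firstDeriv (hU z hz))
      ((hK.hasDerivWithinAt_fst hx hz).prodMk
        (hK.hasDerivWithinAt_fst (hK.contDiffOn_partialFst hx) hz))
  exact hK.partialFst_eq (h.contDiffOn_firstDeriv_comp hK hx hU v) hz.1 hz.2
    ((d1.clm_apply (hasDerivWithinAt_const z.1 T v)).congr_deriv (by simp))

omit [FiniteDimensional ℝ E] in
theorem partialSnd_firstDeriv (v : E × E) {z : ℝ × ℝ} (hz : z ∈ T ×ˢ I) :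
    partialSnd (T ×ˢ I) (fun z => firstDeriv ℓ (x z, partialFst (T ×ˢ I) x z) v) z =
      secondDeriv ℓ (x z, partialFst (T ×ˢ I) x z)
        (partialSnd (T ×ˢ I) x z, partialFst (T ×ˢ I) (partialSnd (T ×ˢ I) x) z) v := by
  have d1 : HasDerivWithinAt (fun σ => firstDeriv ℓ (x (z.1, σ), partialFst (T ×ˢ I) x (z.1, σ)))
      (secondDeriv ℓ (x z, partialFst (T ×ˢ I) x z)
        (partialSnd (T ×ˢ I) x z, partialSnd (T ×ˢ I) (partialFst (T ×ˢ I) x) z)) I z.2 :=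
    HasFDerivAt.comp_hasDerivWithinAt z.2 (h.hasFDerivAt_firstDeriv (hU z hz))
      ((hK.hasDerivWithinAt_snd hx hz).prodMk
        (hK.hasDerivWithinAt_snd (hK.contDiffOn_partialFst hx) hz))
  exact hK.partialSnd_eq (h.contDiffOn_firstDeriv_comp hK hx hU v) hz.1 hz.2
    ((d1.clm_apply (hasDerivWithinAt_const z.2 I v)).congr_deriv (by simp [hK.comm hx hz]))

/-- If the geodesic equation holds to first order, then the linearized Euler-Lagrange equation
holds. -/
theorem hasDerivWithinAt_secondDeriv {s : ℝ} (hs : s ∈ I)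
    (hgeo : ∀ t ∈ T, longDerivLocal ℓ (T ×ˢ I) x (partialFst (T ×ˢ I) x) (t, s) = 0)
    {t : ℝ} (ht : t ∈ T)
    (hgeo' : partialSnd (T ×ˢ I)
      (longDerivLocal ℓ (T ×ˢ I) x (partialFst (T ×ˢ I) x)) (t, s) = 0) (a : E) :
    HasDerivWithinAt (fun τ => secondDeriv ℓ (x (τ, s), partialFst (T ×ˢ I) x (τ, s))
        (partialSnd (T ×ˢ I) x (τ, s), partialFst (T ×ˢ I) (partialSnd (T ×ˢ I) x) (τ, s)) (0, a))
      (secondDeriv ℓ (x (t, s), partialFst (T ×ˢ I) x (t, s))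
        (partialSnd (T ×ˢ I) x (t, s), partialFst (T ×ˢ I) (partialSnd (T ×ˢ I) x) (t, s)) (a, 0))
      T t := by
  have hz : (t, s) ∈ T ×ˢ I := ⟨ht, hs⟩
  have hxt := hK.contDiffOn_partialFst hx
  have hQ := h.contDiffOn_longDerivLocal hK hx hU hxt
  set y := partialFst (T ×ˢ I) x with hy
  set Q := longDerivLocal ℓ (T ×ˢ I) x y with hQdef
  have hxy : ContDiffOn ℝ ∞ (fun z => (x z, y z)) (T ×ˢ I) := hx.prodMk hxt
  have hφ : ∀ v, ContDiffOn ℝ ∞ (fun z => firstDeriv ℓ (x z, y z) v) (T ×ˢ I) :=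
    h.contDiffOn_firstDeriv_comp hK hx hU
  have hD : ContDiffOn ℝ ∞ (fun z => secondDeriv ℓ (x z, y z)) (T ×ˢ I) :=
    h.contDiffOn_secondDeriv.comp hxy hU
  have pt := fun v z hz => h.partialFst_firstDeriv hK hx hU v (z := z) hz
  have ps := fun v z hz => h.partialSnd_firstDeriv hK hx hU v (z := z) hz
  simp only [← hy] at pt ps
  -- The Euler-Lagrange expression of every curve of the variation, with the covariant acceleration
  -- `Q` as error term.
  have hEL : ∀ z ∈ T ×ˢ I, partialFst (T ×ˢ I) (fun z => firstDeriv ℓ (x z, y z) (0, a)) z =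
      firstDeriv ℓ (x z, y z) (a, 0) + secondDeriv ℓ (x z, y z) (0, Q z) (0, a) := fun z hz => by
    have e : ∀ a b : E, (a, b) = (a, 0) + (0, b) := fun a b => by simp
    have h1 := h.secondDeriv_chernMap_snd_snd (hU z hz) a
    simp only at h1
    rw [pt _ z hz, hQdef, longDerivLocal, mk_zero_add, map_add, add_apply, h1, e (y z), map_add,
      add_apply]
    ring
  have hQz : HasDerivWithinAt (fun σ => ((0 : E), Q (t, σ))) 0 I s := by
    have := hK.hasDerivWithinAt_snd hQ hz
    rw [hgeo'] at this
    exact (hasDerivWithinAt_const s I (0 : E)).prodMk this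
  -- Differentiating `hEL` transversally: both `Q` and its transverse derivative vanish here, so the
  -- error term contributes nothing.
  have h1 : partialSnd (T ×ˢ I) (partialFst (T ×ˢ I)
      (fun z => firstDeriv ℓ (x z, y z) (0, a))) (t, s) =
      secondDeriv ℓ (x (t, s), y (t, s)) (partialSnd (T ×ˢ I) x (t, s), partialFst (T ×ˢ I)
        (partialSnd (T ×ˢ I) x) (t, s)) (a, 0) := by
    refine hK.partialSnd_eq (hK.contDiffOn_partialFst (hφ _)) ht hs ?_
    have d1 := (((hK.hasDerivWithinAt_snd hD hz).clm_apply hQz).clm_apply (hasDerivWithinAt_const s I ((0 : E), a)))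
    have d2 := ((hK.hasDerivWithinAt_snd (hφ (a, 0)) hz).add d1).congr (fun σ hσ => hEL (t, σ) ⟨ht, hσ⟩) (hEL _ hz)
    refine d2.congr_deriv ?_
    rw [ps _ _ hz]
    have h00 : ((0 : E), (0 : E)) = 0 := rfl
    simp [hgeo t ht, h00]
  rw [← h1, hK.comm (hφ _) hz]
  exact (hK.hasDerivWithinAt_fst (hK.contDiffOn_partialSnd (hφ _)) hz).congr
    (fun τ hτ => (ps (0, a) (τ, s) ⟨hτ, hs⟩).symm) (ps (0, a) _ hz).symm

end Variation

omit [FiniteDimensional ℝ E] in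
/-- The symplectic form of two solutions of the linearized Euler-Lagrange equation is constant. -/
theorem hasDerivWithinAt_symplectic {T : Set ℝ} {c c' J₁ J₁' J₂ J₂' : ℝ → E} {t : ℝ} (ht : t ∈ T)
    (hT : UniqueDiffOn ℝ T)
    (hU : ∀ t ∈ T, (c t, c' t) ∈ U)
    (hc : DifferentiableOn ℝ c T) (hc' : DifferentiableOn ℝ c' T)
    (hJ₁ : ∀ t ∈ T, HasDerivWithinAt J₁ (J₁' t) T t) (hJ₁' : DifferentiableOn ℝ J₁' T)
    (hJ₂ : ∀ t ∈ T, HasDerivWithinAt J₂ (J₂' t) T t) (hJ₂' : DifferentiableOn ℝ J₂' T)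
    (hEL₁ : ∀ a, HasDerivWithinAt (fun τ => secondDeriv ℓ (c τ, c' τ) (J₁ τ, J₁' τ) (0, a))
      (secondDeriv ℓ (c t, c' t) (J₁ t, J₁' t) (a, 0)) T t)
    (hEL₂ : ∀ a, HasDerivWithinAt (fun τ => secondDeriv ℓ (c τ, c' τ) (J₂ τ, J₂' τ) (0, a))
      (secondDeriv ℓ (c t, c' t) (J₂ t, J₂' t) (a, 0)) T t) :
    HasDerivWithinAt (fun τ => secondDeriv ℓ (c τ, c' τ) (J₂ τ, J₂' τ) (0, J₁ τ)
      - secondDeriv ℓ (c τ, c' τ) (J₁ τ, J₁' τ) (0, J₂ τ)) 0 T t := by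
  -- Integration by parts in differential form, for an arbitrary differentiable `K`. The resulting
  -- derivative is a symmetric bilinear form in `(J, J')` and `(K, K')`, so exchanging the fields
  -- and subtracting gives zero.
  have key : ∀ {J J' K K' : ℝ → E}, (∀ t ∈ T, HasDerivWithinAt J (J' t) T t) →
      DifferentiableOn ℝ J' T → (∀ t ∈ T, HasDerivWithinAt K (K' t) T t) →
      (∀ a, HasDerivWithinAt (fun τ => secondDeriv ℓ (c τ, c' τ) (J τ, J' τ) (0, a))
        (secondDeriv ℓ (c t, c' t) (J t, J' t) (a, 0)) T t) →
      HasDerivWithinAt (fun τ => secondDeriv ℓ (c τ, c' τ) (J τ, J' τ) (0, K τ))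
        (secondDeriv ℓ (c t, c' t) (J t, J' t) (K t, K' t)) T t := by
    intro J J' K K' hJ hJ' hK hEL
    have d1 : DifferentiableWithinAt ℝ (fun τ => secondDeriv ℓ (c τ, c' τ)) T t :=
      ((h.hasFDerivAt_secondDeriv (hU t ht)).comp_hasDerivWithinAt t
        ((hc t ht).hasDerivWithinAt.prodMk
          (hc' t ht).hasDerivWithinAt)).differentiableWithinAt
    have d2 : HasDerivWithinAt (fun τ => secondDeriv ℓ (c τ, c' τ) (J τ, J' τ)) _ T t :=
      (d1.clm_apply ((hJ t ht).differentiableWithinAt.prodMk (hJ' t ht))).hasDerivWithinAt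
    have d3 := d2.clm_apply ((hasDerivWithinAt_const t T (0 : E)).prodMk (hK t ht))
    refine d3.congr_deriv ?_
    -- Freezing `K` at its value `K t` isolates the part of the product rule that the Euler-Lagrange
    -- hypothesis evaluates; the other part is the vertical term in `K' t`.
    have d4 := ((d2.clm_apply (hasDerivWithinAt_const t T ((0 : E), K t))).congr_deriv
      (by simp; rfl))
    have e : (K t, K' t) = (K t, 0) + (0, K' t) := by simp
    rw [e, map_add, (hT t ht).eq_deriv _ (hEL (K t)) d4]
  refine ((key hJ₂ hJ₂' hJ₁ hEL₂).sub (key hJ₁ hJ₁' hJ₂ hEL₁)).congr_deriv ?_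
  rw [h.secondDeriv_comm (hU t ht), sub_self]

end IsLocalPseudoFinsler
end LocalJacobi

/-! ### Components of tangent vectors in preferred charts. -/

section Charts

variable {E : Type*} [NormedAddCommGroup E] [NormedSpace ℝ E]
  {M : Type*} [TopologicalSpace M] [ChartedSpace E M]

/-- The components of a tangent vector in the preferred chart at `p`. -/
def tangentComp (p : M) (v : TangentBundle 𝓘(ℝ, E) M) : E :=
  (mfderiv 𝓘(ℝ, E) 𝓘(ℝ, E) (chartAt E p) v.1 v.2 : E)

variable [IsManifold 𝓘(ℝ, E) ∞ M]

theorem isManifold_one : IsManifold 𝓘(ℝ, E) 1 M :=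
  IsManifold.of_le (n := ∞) (WithTop.coe_le_coe.2 le_top)

/-- This links the definition of `localExpr` to the charts of the tangent bundle. The zero vector at
`p` serves only as base point: the bundle chart depends on `p` alone. -/
theorem tangentMap_chartAt_symm_eq (p : M) {x : E} (hx : x ∈ (chartAt E p).target) (y : E) :
    (tangentMap 𝓘(ℝ, E) 𝓘(ℝ, E) (chartAt E p).symm ⟨x, y⟩ : TangentBundle 𝓘(ℝ, E) M) =
      (extChartAt 𝓘(ℝ, E).tangent (⟨p, 0⟩ : TangentBundle 𝓘(ℝ, E) M)).symm (x, y) := by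
  have := isManifold_one (E := E) (M := M)
  rw [tangentMap_chart_symm (p := (⟨p, 0⟩ : TangentBundle 𝓘(ℝ, E) M)) (q := ⟨x, y⟩) hx]
  rfl

theorem extChartAt_tangent_eq (p : M) {v : TangentBundle 𝓘(ℝ, E) M}
    (hv : v.1 ∈ (chartAt E p).source) :
    extChartAt 𝓘(ℝ, E).tangent (⟨p, 0⟩ : TangentBundle 𝓘(ℝ, E) M) v =
      (chartAt E p v.1, tangentComp p v) := by
  have := isManifold_one (E := E) (M := M)
  have h := tangentMap_chart (p := (⟨p, 0⟩ : TangentBundle 𝓘(ℝ, E) M)) (q := v) hv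
  have h2 := congrArg (Bundle.TotalSpace.toProd E E) h
  rw [Equiv.apply_symm_apply] at h2
  exact h2.symm

theorem mem_extChartAt_tangent_source (p : M) (v : TangentBundle 𝓘(ℝ, E) M) :
    v ∈ (extChartAt 𝓘(ℝ, E).tangent (⟨p, 0⟩ : TangentBundle 𝓘(ℝ, E) M)).source ↔
      v.1 ∈ (chartAt E p).source := by
  have := isManifold_one (E := E) (M := M)
  rw [extChartAt_source, TangentBundle.mem_chart_source_iff]

theorem mem_extChartAt_tangent_target (p : M) (z : E × E) :
    z ∈ (extChartAt 𝓘(ℝ, E).tangent (⟨p, 0⟩ : TangentBundle 𝓘(ℝ, E) M)).target ↔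
      z.1 ∈ (chartAt E p).target := by
  have := isManifold_one (E := E) (M := M)
  have := TangentBundle.mem_chart_target_iff (I := 𝓘(ℝ, E)) (H := E) z
    (⟨p, 0⟩ : TangentBundle 𝓘(ℝ, E) M)
  simp [extChartAt]
  exact this

theorem tangentMap_chartAt_symm_tangentComp (p : M) {v : TangentBundle 𝓘(ℝ, E) M}
    (hv : v.1 ∈ (chartAt E p).source) :
    (tangentMap 𝓘(ℝ, E) 𝓘(ℝ, E) (chartAt E p).symm ⟨chartAt E p v.1, tangentComp (E := E) p v⟩ :
      TangentBundle 𝓘(ℝ, E) M) = v := by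
  rw [tangentMap_chartAt_symm_eq p ((chartAt E p).map_source hv), ← extChartAt_tangent_eq p hv]
  exact (extChartAt 𝓘(ℝ, E).tangent (⟨p, 0⟩ : TangentBundle 𝓘(ℝ, E) M)).left_inv
    ((mem_extChartAt_tangent_source p v).2 hv)

theorem tangentComp_tangentMap_chartAt_symm (p : M) {x : E} (hx : x ∈ (chartAt E p).target)
    (y : E) :
    tangentComp p (tangentMap 𝓘(ℝ, E) 𝓘(ℝ, E) (chartAt E p).symm ⟨x, y⟩) = y := by
  have h1 := extChartAt_tangent_eq p (v := tangentMap 𝓘(ℝ, E) 𝓘(ℝ, E) (chartAt E p).symm ⟨x, y⟩)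
    ((chartAt E p).map_target hx)
  rw [tangentMap_chartAt_symm_eq p hx, PartialEquiv.right_inv _
    ((mem_extChartAt_tangent_target p _).2 hx)] at h1
  rw [tangentMap_chartAt_symm_eq p hx]
  exact (congrArg Prod.snd h1).symm

/-- In the preferred chart at the base point, a tangent vector is its own expression. -/
theorem tangentComp_self (p : M) (v : TangentSpace 𝓘(ℝ, E) p) :
    tangentComp p (⟨p, v⟩ : TangentBundle 𝓘(ℝ, E) M) = v := by
  have := isManifold_one (E := E) (M := M)
  have h := mfderiv_chartAt_eq_tangentCoordChange (I := 𝓘(ℝ, E)) (x := p) (y := p)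
    (mem_chart_source E p)
  rw [tangentComp]
  exact (congrArg (fun A : E →L[ℝ] E => A v) h).trans
    (tangentCoordChange_self (mem_extChartAt_source p))

/-- The transition map from the preferred chart at `q` to the preferred chart at `p`. -/
def transition (q p : M) : E → E := chartAt E p ∘ (chartAt E q).symm

theorem contDiffOn_transition (q p : M) : ContDiffOn ℝ ∞ (transition (E := E) q p)
    ((chartAt E q).symm.trans (chartAt E p)).source := by
  rw [← contMDiffOn_iff_contDiffOn]
  exact (contMDiffOn_chart (I := 𝓘(ℝ, E)) (n := ∞) (x := p)).comp
    ((contMDiffOn_chart_symm (I := 𝓘(ℝ, E)) (n := ∞) (x := q)).mono fun x hx => hx.1)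
    fun x hx => hx.2

theorem fderiv_transition (q p : M) {x : E}
    (hx : x ∈ ((chartAt E q).symm.trans (chartAt E p)).source) (y : E) :
    fderiv ℝ (transition q p) x y =
      tangentComp p (tangentMap 𝓘(ℝ, E) 𝓘(ℝ, E) (chartAt E q).symm ⟨x, y⟩) := by
  have := isManifold_one (E := E) (M := M)
  have h1 : MDifferentiableAt 𝓘(ℝ, E) 𝓘(ℝ, E) (chartAt E p) ((chartAt E q).symm x) :=
    mdifferentiableAt_atlas (chart_mem_atlas E p) hx.2
  have h2 : MDifferentiableAt 𝓘(ℝ, E) 𝓘(ℝ, E) (chartAt E q).symm x :=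
    mdifferentiableAt_atlas_symm (chart_mem_atlas E q) hx.1
  rw [← mfderiv_eq_fderiv, transition, mfderiv_comp x h1 h2]
  rfl

theorem fderiv_transition_tangentComp (q p : M) {v : TangentBundle 𝓘(ℝ, E) M}
    (hq : v.1 ∈ (chartAt E q).source) (hp : v.1 ∈ (chartAt E p).source) :
    fderiv ℝ (transition q p) (chartAt E q v.1) (tangentComp q v) = tangentComp p v := by
  rw [fderiv_transition, tangentMap_chartAt_symm_tangentComp q hq]
  refine ⟨(chartAt E q).map_source hq, ?_⟩
  change (chartAt E q).symm (chartAt E q v.1) ∈ (chartAt E p).source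
  rwa [(chartAt E q).left_inv hq]

end Charts

/-! ### The expression of a pseudo-Finsler metric in a preferred chart. -/

namespace PseudoFinsler

variable {E : Type*} [NormedAddCommGroup E] [NormedSpace ℝ E]
  {M : Type*} [TopologicalSpace M] [ChartedSpace E M] [IsManifold 𝓘(ℝ, E) ∞ M]
  (F : PseudoFinsler E M)

/-- The domain of the expression of `L` in the preferred chart at `p`. -/
def localDomain (p : M) : Set (E × E) :=
  {z | z.1 ∈ (chartAt E p).target ∧
    tangentMap 𝓘(ℝ, E) 𝓘(ℝ, E) (chartAt E p).symm ⟨z.1, z.2⟩ ∈ F.A}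

theorem mem_localDomain (p : M) {v : TangentBundle 𝓘(ℝ, E) M} (hv : v.1 ∈ (chartAt E p).source)
    (hA : v ∈ F.A) : (chartAt E p v.1, tangentComp p v) ∈ F.localDomain p :=
  ⟨(chartAt E p).map_source hv, by rwa [tangentMap_chartAt_symm_tangentComp p hv]⟩

theorem localExpr_tangentComp (p : M) {v : TangentBundle 𝓘(ℝ, E) M}
    (hv : v.1 ∈ (chartAt E p).source) :
    F.localExpr p (chartAt E p v.1) (tangentComp p v) = F.L v := by
  rw [localExpr, tangentMap_chartAt_symm_tangentComp p hv]

theorem localDomain_eq (p : M) : F.localDomain p =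
    (extChartAt 𝓘(ℝ, E).tangent (⟨p, 0⟩ : TangentBundle 𝓘(ℝ, E) M)).target ∩
    (extChartAt 𝓘(ℝ, E).tangent (⟨p, 0⟩ : TangentBundle 𝓘(ℝ, E) M)).symm ⁻¹' F.A := by
  ext z
  rw [mem_inter_iff, mem_extChartAt_tangent_target]
  refine and_congr_right fun hz => ?_
  rw [tangentMap_chartAt_symm_eq p hz]
  rfl

theorem contMDiffOn_extChartAt_tangent_symm (p : M) :
    ContMDiffOn 𝓘(ℝ, E × E) 𝓘(ℝ, E).tangent ∞
      (extChartAt 𝓘(ℝ, E).tangent (⟨p, 0⟩ : TangentBundle 𝓘(ℝ, E) M)).symm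
      (extChartAt 𝓘(ℝ, E).tangent (⟨p, 0⟩ : TangentBundle 𝓘(ℝ, E) M)).target := by
  exact contMDiffOn_extChartAt_symm _

theorem fibreHessian_localExpr (p : M) (x y u w : E) :
    fibreHessian (F.localExpr p x) y u w =
      fibreHessian (fun z : TangentSpace 𝓘(ℝ, E) ((chartAt E p).symm x) =>
        F.L ⟨(chartAt E p).symm x, z⟩)
        (mfderiv 𝓘(ℝ, E) 𝓘(ℝ, E) (chartAt E p).symm x y)
        (mfderiv 𝓘(ℝ, E) 𝓘(ℝ, E) (chartAt E p).symm x u)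
        (mfderiv 𝓘(ℝ, E) 𝓘(ℝ, E) (chartAt E p).symm x w) := by
  let A : E →L[ℝ] TangentSpace 𝓘(ℝ, E) ((chartAt E p).symm x) :=
    mfderiv 𝓘(ℝ, E) 𝓘(ℝ, E) (chartAt E p).symm x
  have hA : ∀ t s : ℝ, A (y + t • u + s • w) = A y + t • A u + s • A w := fun t s => by
    rw [map_add, map_add, map_smul, map_smul]
  have h : ∀ t s : ℝ, F.localExpr p x (y + t • u + s • w) =
      F.L ⟨(chartAt E p).symm x, A y + t • A u + s • A w⟩ := fun t s => by
    rw [← hA]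
    rfl
  simp only [fibreHessian, h]
  rfl

theorem isOpen_localDomain (p : M) : IsOpen (F.localDomain p) := by
  rw [localDomain_eq]
  have ho : IsOpen (extChartAt 𝓘(ℝ, E).tangent (⟨p, 0⟩ : TangentBundle 𝓘(ℝ, E) M)).target :=
    isOpen_extChartAt_target _
  exact (contMDiffOn_extChartAt_tangent_symm p).continuousOn.isOpen_inter_preimage ho F.isOpen_A

theorem contDiffOn_localExpr (p : M) :
    ContDiffOn ℝ ∞ (Function.uncurry (F.localExpr p)) (F.localDomain p) := by
  rw [← contMDiffOn_iff_contDiffOn]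
  have h1 : ContMDiffOn 𝓘(ℝ, E × E) 𝓘(ℝ, ℝ) ∞
      (F.L ∘ (extChartAt 𝓘(ℝ, E).tangent (⟨p, 0⟩ : TangentBundle 𝓘(ℝ, E) M)).symm)
      (F.localDomain p) := by
    rw [localDomain_eq]
    exact F.smooth_L.comp ((contMDiffOn_extChartAt_tangent_symm p).mono inter_subset_left)
      inter_subset_right
  refine h1.congr fun z hz => ?_
  rw [Function.comp_apply, ← tangentMap_chartAt_symm_eq p hz.1]
  rfl

theorem isLocalPseudoFinsler (p : M) :
    IsLocalPseudoFinsler (F.localExpr p) (F.localDomain p) where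
  isOpen := F.isOpen_localDomain p
  smooth := F.contDiffOn_localExpr p
  euler := by
    intro z hz
    have hU : F.localDomain p ∈ nhds z := F.isOpen_localDomain p |>.mem_nhds hz
    have hd : HasFDerivAt (Function.uncurry (F.localExpr p))
        (fderiv ℝ (Function.uncurry (F.localExpr p)) z) z :=
      (((F.contDiffOn_localExpr p).contDiffAt hU).differentiableAt (by simp)).hasFDerivAt
    have h1 : HasDerivAt (fun r : ℝ => Function.uncurry (F.localExpr p) (z + r • (0, z.2)))
        (fderiv ℝ (Function.uncurry (F.localExpr p)) z (0, z.2)) 0 := hd.hasLineDerivAt _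
    have h2 : HasDerivAt (fun r : ℝ => (1 + r) ^ 2 * Function.uncurry (F.localExpr p) z)
        (2 * Function.uncurry (F.localExpr p) z) 0 := by
      have := (((hasDerivAt_id (0 : ℝ)).const_add 1).pow 2).mul_const
        (Function.uncurry (F.localExpr p) z)
      simpa using this
    refine h1.unique (h2.congr_of_eventuallyEq ?_)
    -- Homogeneity is applied with the factor `1 + r`, which is positive for `r > -1`.
    filter_upwards [lt_mem_nhds (show (-1 : ℝ) < 0 by norm_num)] with r hr
    have h3 := F.homogeneous ((chartAt E p).symm z.1)
      (mfderiv 𝓘(ℝ, E) 𝓘(ℝ, E) (chartAt E p).symm z.1 z.2) (1 + r) (by linarith) hz.2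
    have h4 : z + r • ((0 : E), z.2) = (z.1, (1 + r) • z.2) := by
      ext <;> simp [add_smul]
    let A : E →L[ℝ] TangentSpace 𝓘(ℝ, E) ((chartAt E p).symm z.1) :=
      mfderiv 𝓘(ℝ, E) 𝓘(ℝ, E) (chartAt E p).symm z.1
    have h5 : A ((1 + r) • z.2) = (1 + r) • A z.2 := map_smul _ _ _
    rw [h4]
    change F.L ⟨(chartAt E p).symm z.1, A ((1 + r) • z.2)⟩ = _
    rw [h5]
    exact h3
  nondegenerate := by
    intro z hz u hu
    have := isManifold_one (E := E) (M := M)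
    -- Surjectivity lets `hu` test against all tangent vectors; injectivity brings the conclusion
    -- back to `u`.
    have hbij := (mdifferentiable_chart (I := 𝓘(ℝ, E)) p).symm.mfderiv_bijective (x := z.1) hz.1
    have h1 := F.nondegenerate _ _ hz.2 (mfderiv 𝓘(ℝ, E) 𝓘(ℝ, E) (chartAt E p).symm z.1 u)
      fun w => by
        obtain ⟨w, rfl⟩ := hbij.2 w
        exact (F.fibreHessian_localExpr p z.1 z.2 u w).symm.trans (hu w)
    exact hbij.1 (h1.trans (map_zero _).symm)

end PseudoFinsler

/-! ### Components of velocities and of smooth fields. -/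

section Charts

variable {E : Type*} [NormedAddCommGroup E] [NormedSpace ℝ E]
  {M : Type*} [TopologicalSpace M] [ChartedSpace E M]

theorem tangentComp_sub (p : M) {q : M} (u v : TangentSpace 𝓘(ℝ, E) q) :
    tangentComp p (⟨q, u - v⟩ : TangentBundle 𝓘(ℝ, E) M) =
      tangentComp p (⟨q, u⟩ : TangentBundle 𝓘(ℝ, E) M) -
        tangentComp p (⟨q, v⟩ : TangentBundle 𝓘(ℝ, E) M) :=
  map_sub (mfderiv 𝓘(ℝ, E) 𝓘(ℝ, E) (chartAt E p) q) u v

theorem tangentComp_zero (p q : M) :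
    tangentComp p (⟨q, 0⟩ : TangentBundle 𝓘(ℝ, E) M) = 0 :=
  map_zero (mfderiv 𝓘(ℝ, E) 𝓘(ℝ, E) (chartAt E p) q)

variable [IsManifold 𝓘(ℝ, E) ∞ M]

theorem tangentComp_velocity {S : Set ℝ} {c : ℝ → M} {t : ℝ} (p : M)
    (hS : UniqueDiffWithinAt ℝ S t) (hc : MDifferentiableWithinAt 𝓘(ℝ, ℝ) 𝓘(ℝ, E) c S t)
    (hp : c t ∈ (chartAt E p).source) :
    tangentComp p (⟨c t, velocity S c t⟩ : TangentBundle 𝓘(ℝ, E) M) =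
      derivWithin (fun τ => chartAt E p (c τ)) S t := by
  have := isManifold_one (E := E) (M := M)
  have h1 : MDifferentiableAt 𝓘(ℝ, E) 𝓘(ℝ, E) (chartAt E p) (c t) :=
    mdifferentiableAt_atlas (chart_mem_atlas E p) hp
  have h2 := mfderiv_comp_mfderivWithin t h1 hc hS.uniqueMDiffWithinAt
  rw [mfderivWithin_eq_fderivWithin] at h2
  exact (congrArg (fun A : ℝ →L[ℝ] E => A 1) h2).symm

theorem ContMDiffOn.contDiffOn_chartAt {G : Type*} [NormedAddCommGroup G] [NormedSpace ℝ G]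
    {g : G → M} {K : Set G} (hg : ContMDiffOn 𝓘(ℝ, G) 𝓘(ℝ, E) ∞ g K) (p : M)
    (hp : ∀ z ∈ K, g z ∈ (chartAt E p).source) :
    ContDiffOn ℝ ∞ (fun z => chartAt E p (g z)) K := by
  rw [← contMDiffOn_iff_contDiffOn]
  exact (contMDiffOn_chart (I := 𝓘(ℝ, E)) (n := ∞) (x := p)).comp hg hp

theorem ContMDiffOn.contDiffOn_tangentComp {G : Type*} [NormedAddCommGroup G] [NormedSpace ℝ G]
    {g : G → TangentBundle 𝓘(ℝ, E) M} {K : Set G}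
    (hg : ContMDiffOn 𝓘(ℝ, G) 𝓘(ℝ, E).tangent ∞ g K) (p : M)
    (hp : ∀ z ∈ K, (g z).1 ∈ (chartAt E p).source) :
    ContDiffOn ℝ ∞ (fun z => tangentComp p (g z)) K := by
  have h1 : ContMDiffOn 𝓘(ℝ, E).tangent 𝓘(ℝ, E × E) ∞
      (extChartAt 𝓘(ℝ, E).tangent (⟨p, 0⟩ : TangentBundle 𝓘(ℝ, E) M))
      (chartAt (ModelProd E E) (⟨p, 0⟩ : TangentBundle 𝓘(ℝ, E) M)).source :=
    contMDiffOn_extChartAt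
  have h2 := h1.comp hg fun z hz => by
    have := (mem_extChartAt_tangent_source p (g z)).2 (hp z hz)
    rwa [extChartAt_source] at this
  rw [contMDiffOn_iff_contDiffOn] at h2
  refine (contDiff_snd.comp_contDiffOn h2).congr fun z hz => ?_
  rw [Function.comp_apply, Function.comp_apply, extChartAt_tangent_eq p (hp z hz)]

end Charts

/-! ### Chart independence of the metric data and of the covariant derivative. -/

namespace PseudoFinsler

variable {E : Type*} [NormedAddCommGroup E] [NormedSpace ℝ E]
  {M : Type*} [TopologicalSpace M] [ChartedSpace E M] [IsManifold 𝓘(ℝ, E) ∞ M]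
  (F : PseudoFinsler E M)

theorem isCoordinateChange (q p : M) : IsCoordinateChange (F.localExpr q) (F.localExpr p)
    ((chartAt E q).symm.trans (chartAt E p)).source (transition q p) where
  isOpen := ((chartAt E q).symm.trans (chartAt E p)).open_source
  smooth := contDiffOn_transition q p
  -- The derivative of the reverse transition is a left inverse.
  injective := by
    intro x hx
    have h1 : ∀ y, fderiv ℝ (transition p q) (transition q p x) (fderiv ℝ (transition q p) x y) =
        y := fun y => by
      have h2 := fderiv_transition_tangentComp p q
        (v := tangentMap 𝓘(ℝ, E) 𝓘(ℝ, E) (chartAt E q).symm ⟨x, y⟩) hx.2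
        ((chartAt E q).map_target hx.1)
      rw [tangentComp_tangentMap_chartAt_symm q hx.1, ← fderiv_transition q p hx] at h2
      exact h2
    exact Function.LeftInverse.injective h1
  eq := by
    intro x hx y
    have h1 := F.localExpr_tangentComp p
      (v := tangentMap 𝓘(ℝ, E) 𝓘(ℝ, E) (chartAt E q).symm ⟨x, y⟩) hx.2
    rw [← fderiv_transition q p hx] at h1
    exact h1.symm

theorem fundamentalTensor_eq (p : M) {q : M} (hq : q ∈ (chartAt E p).source)
    (v u w : TangentSpace 𝓘(ℝ, E) q) (hv : (⟨q, v⟩ : TangentBundle 𝓘(ℝ, E) M) ∈ F.A) :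
    F.fundamentalTensor v u w = 1 / 2 * secondDeriv (F.localExpr p)
      (chartAt E p q, tangentComp p (⟨q, v⟩ : TangentBundle 𝓘(ℝ, E) M))
      (0, tangentComp p (⟨q, u⟩ : TangentBundle 𝓘(ℝ, E) M))
      (0, tangentComp p (⟨q, w⟩ : TangentBundle 𝓘(ℝ, E) M)) := by
  have h1 := (F.isLocalPseudoFinsler p).fibreHessian_eq (F.mem_localDomain p hq hv)
    (tangentComp p (⟨q, u⟩ : TangentBundle 𝓘(ℝ, E) M))
    (tangentComp p (⟨q, w⟩ : TangentBundle 𝓘(ℝ, E) M))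
  rw [← h1, fundamentalTensor]
  have h2 : ∀ t s : ℝ, F.L ⟨q, v + t • u + s • w⟩ = F.localExpr p (chartAt E p q)
      (tangentComp p (⟨q, v⟩ : TangentBundle 𝓘(ℝ, E) M)
        + t • tangentComp p (⟨q, u⟩ : TangentBundle 𝓘(ℝ, E) M)
        + s • tangentComp p (⟨q, w⟩ : TangentBundle 𝓘(ℝ, E) M)) := fun t s => by
    rw [← F.localExpr_tangentComp p (v := ⟨q, v + t • u + s • w⟩) hq]
    congr 1
    let A : TangentSpace 𝓘(ℝ, E) q →L[ℝ] E := mfderiv 𝓘(ℝ, E) 𝓘(ℝ, E) (chartAt E p) q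
    change A (v + t • u + s • w) = A v + t • A u + s • A w
    rw [map_add, map_add, map_smul, map_smul]
  simp only [fibreHessian, h2]

variable [FiniteDimensional ℝ E]

/-- The covariant derivative along a curve may be computed in any chart. -/
theorem tangentComp_covDeriv {S : Set ℝ} {c : ℝ → M} {W X : ∀ t, TangentSpace 𝓘(ℝ, E) (c t)}
    {t : ℝ} (p : M) (ht : t ∈ S) (hS : UniqueDiffWithinAt ℝ S t)
    (hc : MDifferentiableWithinAt 𝓘(ℝ, ℝ) 𝓘(ℝ, E) c S t) (hp : c t ∈ (chartAt E p).source)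
    (hA : (⟨c t, W t⟩ : TangentBundle 𝓘(ℝ, E) M) ∈ F.A)
    (hX : DifferentiableWithinAt ℝ
      (fun τ => tangentComp p (⟨c τ, X τ⟩ : TangentBundle 𝓘(ℝ, E) M)) S t) :
    tangentComp p (⟨c t, F.covDeriv S c W X t⟩ : TangentBundle 𝓘(ℝ, E) M) =
      derivWithin (fun τ => tangentComp p (⟨c τ, X τ⟩ : TangentBundle 𝓘(ℝ, E) M)) S t
        + chernMap (F.localExpr p)
          (chartAt E p (c t), tangentComp p (⟨c t, W t⟩ : TangentBundle 𝓘(ℝ, E) M))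
          (tangentComp p (⟨c t, X t⟩ : TangentBundle 𝓘(ℝ, E) M))
          (derivWithin (fun τ => chartAt E p (c τ)) S t) := by
  have := isManifold_one (E := E) (M := M)
  set q : M := c t with hq
  have hqq : q ∈ (chartAt E q).source := mem_chart_source E q
  have hx0 : chartAt E p q ∈ ((chartAt E p).symm.trans (chartAt E q)).source := by
    refine ⟨(chartAt E p).map_source hp, ?_⟩
    change (chartAt E p).symm (chartAt E p q) ∈ (chartAt E q).source
    rwa [(chartAt E p).left_inv hp]
  have hψ := F.isCoordinateChange p q
  have hcomp : ∀ v : TangentSpace 𝓘(ℝ, E) q, (v : E) = fderiv ℝ (transition p q)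
      (chartAt E p q) (tangentComp p (⟨q, v⟩ : TangentBundle 𝓘(ℝ, E) M)) := fun v =>
    (tangentComp_self q v).symm.trans
      (fderiv_transition_tangentComp p q (v := ⟨q, v⟩) hp hqq).symm
  have hev : ∀ᶠ τ in nhdsWithin t S, c τ ∈ (chartAt E p).source ∧ c τ ∈ (chartAt E q).source :=
    hc.continuousWithinAt (((chartAt E p).open_source.inter (chartAt E q).open_source).mem_nhds
      ⟨hp, hqq⟩)
  have hcp : DifferentiableWithinAt ℝ (fun τ => chartAt E p (c τ)) S t := by
    rw [← mdifferentiableWithinAt_iff_differentiableWithinAt]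
    exact (mdifferentiableAt_atlas (chart_mem_atlas E p) hp).comp_mdifferentiableWithinAt t hc
  -- The components in the chart at `q` are the Jacobian of the transition applied to those at `p`,
  -- so differentiating them along the curve creates a second-derivative term.
  have hD : HasDerivWithinAt
      (fun τ => tangentComp q (⟨c τ, X τ⟩ : TangentBundle 𝓘(ℝ, E) M))
      (fderiv ℝ (fderiv ℝ (transition p q)) (chartAt E p q)
          (derivWithin (fun τ => chartAt E p (c τ)) S t)
          (tangentComp p (⟨q, X t⟩ : TangentBundle 𝓘(ℝ, E) M))
        + fderiv ℝ (transition p q) (chartAt E p q)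
          (derivWithin (fun τ => tangentComp p (⟨c τ, X τ⟩ : TangentBundle 𝓘(ℝ, E) M)) S t)) S t := by
    have h1 : HasDerivWithinAt (fun τ => fderiv ℝ (transition p q) (chartAt E p (c τ))) _ S t :=
      HasFDerivAt.comp_hasDerivWithinAt t (hψ.hasFDerivAt_fderiv hx0) hcp.hasDerivWithinAt
    refine (h1.clm_apply hX.hasDerivWithinAt).congr_of_eventuallyEq_of_mem ?_ ht
    filter_upwards [hev] with τ hτ
    exact (fderiv_transition_tangentComp p q (v := ⟨c τ, X τ⟩) hτ.1 hτ.2).symm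
  set target : E := derivWithin (fun τ => tangentComp p (⟨c τ, X τ⟩ : TangentBundle 𝓘(ℝ, E) M)) S t
    + chernMap (F.localExpr p)
      (chartAt E p q, tangentComp p (⟨q, W t⟩ : TangentBundle 𝓘(ℝ, E) M))
      (tangentComp p (⟨q, X t⟩ : TangentBundle 𝓘(ℝ, E) M))
      (derivWithin (fun τ => chartAt E p (c τ)) S t) with htarget
  have hWq : (chartAt E q q, (W t : E)) ∈ F.localDomain q := by
    have := F.mem_localDomain q (v := ⟨q, W t⟩) hqq hA
    rwa [tangentComp_self] at this
  have hWp := F.mem_localDomain p (v := ⟨q, W t⟩) hp hA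
  have hψq : transition p q (chartAt E p q) = chartAt E q q := by
    change chartAt E q ((chartAt E p).symm (chartAt E p q)) = _
    rw [(chartAt E p).left_inv hp]
  -- The second-derivative term of `hD` cancels the inhomogeneous term of `chernMap_eq`, after its
  -- two arguments are exchanged by symmetry.
  have hkey : (F.covDeriv S c W X t : E) =
      fderiv ℝ (transition p q) (chartAt E p q) target := by
    have h1 : (F.covDeriv S c W X t : E) =
        derivWithin (fun τ => tangentComp q (⟨c τ, X τ⟩ : TangentBundle 𝓘(ℝ, E) M)) S t
        + chernSymbol (F.localExpr q) (chartAt E q q) (W t) (X t) (velocity (E := E) S c t) := rfl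
    have h2 := (F.isLocalPseudoFinsler q).chernSymbol_eq_chernMap hWq
    have h3 := hψ.chernMap_eq (F.isLocalPseudoFinsler p) (F.isLocalPseudoFinsler q)
      (z := (chartAt E p q, tangentComp p (⟨q, W t⟩ : TangentBundle 𝓘(ℝ, E) M))) hx0 hWp
      (by
        rw [← hcomp (W t), hψq]
        exact hWq) (tangentComp p (⟨q, X t⟩ : TangentBundle 𝓘(ℝ, E) M))
      (tangentComp p (⟨q, velocity S c t⟩ : TangentBundle 𝓘(ℝ, E) M))
    simp only at h2 h3
    rw [← hcomp (W t), ← hcomp (X t), ← hcomp (velocity S c t), hψq,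
      tangentComp_velocity p hS hc hp, hψ.secondFDeriv_comm hx0] at h3
    rw [h1, h2, hD.derivWithin hS, htarget, map_add, h3]
    abel
  -- `hkey` is an identity in the chart at `q`; the transition back to `p` recovers `target` itself.
  have hv : (tangentMap 𝓘(ℝ, E) 𝓘(ℝ, E) (chartAt E p).symm
      ⟨chartAt E p q, target⟩ : TangentBundle 𝓘(ℝ, E) M).1 = q := (chartAt E p).left_inv hp
  have h4 := fderiv_transition_tangentComp q p (v := tangentMap 𝓘(ℝ, E) 𝓘(ℝ, E)
    (chartAt E p).symm ⟨chartAt E p q, target⟩) (by rwa [hv]) (by rwa [hv])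
  rw [tangentComp_tangentMap_chartAt_symm p ((chartAt E p).map_source hp),
    ← fderiv_transition p q hx0, ← hkey, hv] at h4
  have h5 := fderiv_transition_tangentComp q p (v := ⟨q, F.covDeriv S c W X t⟩) hqq hp
  rw [tangentComp_self] at h5
  exact h5.symm.trans h4

end PseudoFinsler

/-! ### Variations on a box mapped into a single chart. -/

theorem IsBox.inter {S S' N N' : Set ℝ} (h : IsBox S S') (hN : IsOpen N) (hN' : IsOpen N') :
    IsBox (S ∩ N) (S' ∩ N') := by
  have key : ∀ {S N : Set ℝ}, S ⊆ closure (interior S) → IsOpen N →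
      S ∩ N ⊆ closure (interior (S ∩ N)) := fun {S N} hS hN z hz => by
    rw [interior_inter, hN.interior_eq]
    exact hN.closure_inter ⟨hS hz.1, hz.2⟩
  exact ⟨h.fst.inter hN, h.snd.inter hN', key h.subset_fst hN, key h.subset_snd hN'⟩

theorem isBox_Icc_Ioo {a b : ℝ} (hab : a < b) (ε : ℝ) :
    IsBox (Icc a b) (Ioo (-ε) ε) where
  fst := uniqueDiffOn_Icc hab
  snd := uniqueDiffOn_Ioo _ _
  subset_fst := by rw [interior_Icc, closure_Ioo hab.ne]
  subset_snd := by rw [interior_Ioo]; exact subset_closure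

namespace PseudoFinsler

variable {E : Type*} [NormedAddCommGroup E] [NormedSpace ℝ E] [FiniteDimensional ℝ E]
  {M : Type*} [TopologicalSpace M] [ChartedSpace E M] [IsManifold 𝓘(ℝ, E) ∞ M]
  (F : PseudoFinsler E M)

section Variation

variable {a b ε : ℝ} (hab : a < b) {γ : ℝ → M} {W : ∀ t, TangentSpace 𝓘(ℝ, E) (γ t)}
  {Λ : ℝ → ℝ → M} (hΛ : F.IsVariation a b ε γ W Λ) (p : M) {N N' : Set ℝ}
  (hN : IsOpen N) (hN' : IsOpen N')
  (hp : ∀ t ∈ Icc a b ∩ N, ∀ s ∈ Ioo (-ε) ε ∩ N', Λ t s ∈ (chartAt E p).source)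

omit [FiniteDimensional ℝ E] [IsManifold 𝓘(ℝ, E) ∞ M] in
theorem mdifferentiableWithinAt_fst
    (hΛ : ContMDiffOn 𝓘(ℝ, ℝ × ℝ) 𝓘(ℝ, E) ∞ (fun z : ℝ × ℝ => Λ z.1 z.2)
      (Icc a b ×ˢ Ioo (-ε) ε)) {t s : ℝ} (ht : t ∈ Icc a b) (hs : s ∈ Ioo (-ε) ε) :
    MDifferentiableWithinAt 𝓘(ℝ, ℝ) 𝓘(ℝ, E) (fun τ => Λ τ s) (Icc a b) t := by
  have h1 : ContMDiffWithinAt 𝓘(ℝ, ℝ) 𝓘(ℝ, ℝ × ℝ) ∞ (fun τ : ℝ => (τ, s)) (Icc a b) t :=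
    (contDiff_id.prodMk contDiff_const).contDiffWithinAt.contMDiffWithinAt
  have h2 : MapsTo (fun τ : ℝ => (τ, s)) (Icc a b) (Icc a b ×ˢ Ioo (-ε) ε) := fun τ hτ => ⟨hτ, hs⟩
  exact ((hΛ (t, s) ⟨ht, hs⟩).comp t h1 h2).mdifferentiableWithinAt (by simp)

omit [FiniteDimensional ℝ E] [IsManifold 𝓘(ℝ, E) ∞ M] in
theorem mdifferentiableWithinAt_snd
    (hΛ : ContMDiffOn 𝓘(ℝ, ℝ × ℝ) 𝓘(ℝ, E) ∞ (fun z : ℝ × ℝ => Λ z.1 z.2)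
      (Icc a b ×ˢ Ioo (-ε) ε)) {t s : ℝ} (ht : t ∈ Icc a b) (hs : s ∈ Ioo (-ε) ε) :
    MDifferentiableWithinAt 𝓘(ℝ, ℝ) 𝓘(ℝ, E) (fun σ => Λ t σ) (Ioo (-ε) ε) s := by
  have h1 : ContMDiffWithinAt 𝓘(ℝ, ℝ) 𝓘(ℝ, ℝ × ℝ) ∞ (fun σ : ℝ => (t, σ)) (Ioo (-ε) ε) s :=
    (contDiff_const.prodMk contDiff_id).contDiffWithinAt.contMDiffWithinAt
  have h2 : MapsTo (fun σ : ℝ => (t, σ)) (Ioo (-ε) ε) (Icc a b ×ˢ Ioo (-ε) ε) :=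
    fun σ hσ => ⟨ht, hσ⟩
  exact ((hΛ (t, s) ⟨ht, hs⟩).comp s h1 h2).mdifferentiableWithinAt (by simp)

/-- The expression of a variation in the preferred chart at `p`. -/
def variationComp (p : M) (Λ : ℝ → ℝ → M) (z : ℝ × ℝ) : E := chartAt E p (Λ z.1 z.2)

/-- The expression of a vector field along a variation in the preferred chart at `p`. -/
def fieldComp (p : M) (Λ : ℝ → ℝ → M) (V : ∀ t s, TangentSpace 𝓘(ℝ, E) (Λ t s)) (z : ℝ × ℝ) : E :=
  tangentComp p (⟨Λ z.1 z.2, V z.1 z.2⟩ : TangentBundle 𝓘(ℝ, E) M)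

include hΛ hp

omit [FiniteDimensional ℝ E] in
theorem contDiffOn_variationComp : ContDiffOn ℝ ∞ (variationComp (E := E) p Λ)
    ((Icc a b ∩ N) ×ˢ (Ioo (-ε) ε ∩ N')) :=
  ContMDiffOn.contDiffOn_chartAt (hΛ.smooth.mono (prod_mono inter_subset_left inter_subset_left)) p
    fun _ hz => hp _ hz.1 _ hz.2

include hab hN hN'

omit [FiniteDimensional ℝ E] hΛ hp in
theorem isBox_inter : IsBox (Icc a b ∩ N) (Ioo (-ε) ε ∩ N') :=
  (isBox_Icc_Ioo hab ε).inter hN hN'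

-- Intersecting with the open set `N` does not affect derivatives within the interval. Partial
-- derivatives on the small box thus compute the intrinsic ones, which are taken within all of `Icc
-- a b`.
omit [FiniteDimensional ℝ E] [IsManifold 𝓘(ℝ, E) ∞ M] hΛ hp in
theorem hasDerivWithinAt_Icc {G : Type*} [NormedAddCommGroup G] [NormedSpace ℝ G]
    {f : ℝ × ℝ → G}
    (hf : ContDiffOn ℝ ∞ f ((Icc a b ∩ N) ×ˢ (Ioo (-ε) ε ∩ N'))) {t s : ℝ} (ht : t ∈ Icc a b ∩ N)
    (hs : s ∈ Ioo (-ε) ε ∩ N') :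
    HasDerivWithinAt (fun τ => f (τ, s))
      (partialFst ((Icc a b ∩ N) ×ˢ (Ioo (-ε) ε ∩ N')) f (t, s)) (Icc a b) t :=
  (hasDerivWithinAt_inter (hN.mem_nhds ht.2)).1
    (((isBox_Icc_Ioo hab ε).inter hN hN').hasDerivWithinAt_fst hf (z := (t, s)) ⟨ht, hs⟩)

omit [FiniteDimensional ℝ E] [IsManifold 𝓘(ℝ, E) ∞ M] hΛ hp in
theorem hasDerivWithinAt_Ioo {G : Type*} [NormedAddCommGroup G] [NormedSpace ℝ G]
    {f : ℝ × ℝ → G}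
    (hf : ContDiffOn ℝ ∞ f ((Icc a b ∩ N) ×ˢ (Ioo (-ε) ε ∩ N'))) {t s : ℝ} (ht : t ∈ Icc a b ∩ N)
    (hs : s ∈ Ioo (-ε) ε ∩ N') :
    HasDerivWithinAt (fun σ => f (t, σ))
      (partialSnd ((Icc a b ∩ N) ×ˢ (Ioo (-ε) ε ∩ N')) f (t, s)) (Ioo (-ε) ε) s :=
  (hasDerivWithinAt_inter (hN'.mem_nhds hs.2)).1
    (((isBox_Icc_Ioo hab ε).inter hN hN').hasDerivWithinAt_snd hf (z := (t, s)) ⟨ht, hs⟩)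

omit [FiniteDimensional ℝ E] in
theorem tangentComp_longVelocity {t s : ℝ} (ht : t ∈ Icc a b ∩ N) (hs : s ∈ Ioo (-ε) ε ∩ N') :
    tangentComp p (⟨Λ t s, longVelocity a b Λ t s⟩ : TangentBundle 𝓘(ℝ, E) M) =
      partialFst ((Icc a b ∩ N) ×ˢ (Ioo (-ε) ε ∩ N')) (variationComp p Λ) (t, s) := by
  have hS := uniqueDiffOn_Icc hab t ht.1
  rw [← (hasDerivWithinAt_Icc hab hN hN'
    (F.contDiffOn_variationComp hΛ p hp) ht hs).derivWithin hS]
  exact tangentComp_velocity p hS (mdifferentiableWithinAt_fst hΛ.smooth ht.1 hs.1) (hp t ht s hs)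

omit [FiniteDimensional ℝ E] in
theorem tangentComp_transVelocity {t s : ℝ} (ht : t ∈ Icc a b ∩ N) (hs : s ∈ Ioo (-ε) ε ∩ N') :
    tangentComp p (⟨Λ t s, transVelocity ε Λ t s⟩ : TangentBundle 𝓘(ℝ, E) M) =
      partialSnd ((Icc a b ∩ N) ×ˢ (Ioo (-ε) ε ∩ N')) (variationComp p Λ) (t, s) := by
  have hS := uniqueDiffOn_Ioo (-ε) ε s hs.1
  rw [← (hasDerivWithinAt_Ioo hab hN hN'
    (F.contDiffOn_variationComp hΛ p hp) ht hs).derivWithin hS]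
  exact tangentComp_velocity p hS (mdifferentiableWithinAt_snd hΛ.smooth ht.1 hs.1) (hp t ht s hs)

omit [FiniteDimensional ℝ E] in
theorem variationComp_mem_localDomain {z : ℝ × ℝ}
    (hz : z ∈ (Icc a b ∩ N) ×ˢ (Ioo (-ε) ε ∩ N')) :
    (variationComp p Λ z,
      partialFst ((Icc a b ∩ N) ×ˢ (Ioo (-ε) ε ∩ N')) (variationComp p Λ) z) ∈
      F.localDomain p := by
  rw [← F.tangentComp_longVelocity hab hΛ p hN hN' hp hz.1 hz.2]
  exact F.mem_localDomain p (v := ⟨Λ z.1 z.2, longVelocity a b Λ z.1 z.2⟩) (hp _ hz.1 _ hz.2)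
    (hΛ.admissible _ hz.1.1 _ hz.2.1)

theorem fieldComp_longDeriv {V : ∀ t s, TangentSpace 𝓘(ℝ, E) (Λ t s)}
    (hV : ContDiffOn ℝ ∞ (fieldComp p Λ V) ((Icc a b ∩ N) ×ˢ (Ioo (-ε) ε ∩ N'))) :
    EqOn (fieldComp p Λ (F.longDeriv a b Λ V))
      (longDerivLocal (F.localExpr p) ((Icc a b ∩ N) ×ˢ (Ioo (-ε) ε ∩ N')) (variationComp p Λ)
        (fieldComp p Λ V)) ((Icc a b ∩ N) ×ˢ (Ioo (-ε) ε ∩ N')) := by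
  rintro ⟨t, s⟩ ⟨ht, hs⟩
  have hS := uniqueDiffOn_Icc hab t ht.1
  have h1 := hasDerivWithinAt_Icc hab hN hN' hV ht hs
  have h2 := hasDerivWithinAt_Icc hab hN hN' (F.contDiffOn_variationComp hΛ p hp) ht hs
  have h3 := F.tangentComp_covDeriv (W := fun τ => longVelocity a b Λ τ s) (X := fun τ => V τ s)
    p ht.1 hS (mdifferentiableWithinAt_fst hΛ.smooth ht.1 hs.1) (hp t ht s hs)
    (hΛ.admissible t ht.1 s hs.1) h1.differentiableWithinAt
  rw [F.tangentComp_longVelocity hab hΛ p hN hN' hp ht hs] at h3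
  refine h3.trans ?_
  rw [longDerivLocal, ← h1.derivWithin hS, ← h2.derivWithin hS]
  rfl

theorem fieldComp_transDeriv {V : ∀ t s, TangentSpace 𝓘(ℝ, E) (Λ t s)}
    (hV : ContDiffOn ℝ ∞ (fieldComp p Λ V) ((Icc a b ∩ N) ×ˢ (Ioo (-ε) ε ∩ N'))) :
    EqOn (fieldComp p Λ (F.transDeriv a b ε Λ V))
      (transDerivLocal (F.localExpr p) ((Icc a b ∩ N) ×ˢ (Ioo (-ε) ε ∩ N')) (variationComp p Λ)
        (fieldComp p Λ V)) ((Icc a b ∩ N) ×ˢ (Ioo (-ε) ε ∩ N')) := by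
  rintro ⟨t, s⟩ ⟨ht, hs⟩
  have hS := uniqueDiffOn_Ioo (-ε) ε s hs.1
  have h1 := hasDerivWithinAt_Ioo hab hN hN' hV ht hs
  have h2 := hasDerivWithinAt_Ioo hab hN hN' (F.contDiffOn_variationComp hΛ p hp) ht hs
  have h3 := F.tangentComp_covDeriv (W := fun σ => longVelocity a b Λ t σ) (X := fun σ => V t σ)
    p hs.1 hS (mdifferentiableWithinAt_snd hΛ.smooth ht.1 hs.1) (hp t ht s hs)
    (hΛ.admissible t ht.1 s hs.1) h1.differentiableWithinAt
  rw [F.tangentComp_longVelocity hab hΛ p hN hN' hp ht hs] at h3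
  refine h3.trans ?_
  rw [transDerivLocal, ← h1.derivWithin hS, ← h2.derivWithin hS]
  rfl

theorem tangentComp_variationCurvature {V : ∀ t s, TangentSpace 𝓘(ℝ, E) (Λ t s)}
    (hV : ContDiffOn ℝ ∞ (fieldComp p Λ V) ((Icc a b ∩ N) ×ˢ (Ioo (-ε) ε ∩ N'))) {t s : ℝ}
    (ht : t ∈ Icc a b ∩ N) (hs : s ∈ Ioo (-ε) ε ∩ N') :
    tangentComp p (⟨Λ t s, F.variationCurvature a b ε Λ V t s⟩ : TangentBundle 𝓘(ℝ, E) M) =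
      longDerivLocal (F.localExpr p) ((Icc a b ∩ N) ×ˢ (Ioo (-ε) ε ∩ N')) (variationComp p Λ)
        (transDerivLocal (F.localExpr p) ((Icc a b ∩ N) ×ˢ (Ioo (-ε) ε ∩ N'))
          (variationComp p Λ) (fieldComp p Λ V)) (t, s) -
      transDerivLocal (F.localExpr p) ((Icc a b ∩ N) ×ˢ (Ioo (-ε) ε ∩ N')) (variationComp p Λ)
        (longDerivLocal (F.localExpr p) ((Icc a b ∩ N) ×ˢ (Ioo (-ε) ε ∩ N'))
          (variationComp p Λ) (fieldComp p Λ V)) (t, s) := by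
  have hz : (t, s) ∈ (Icc a b ∩ N) ×ˢ (Ioo (-ε) ε ∩ N') := ⟨ht, hs⟩
  have hK := isBox_inter (ε := ε) hab hN hN'
  have hx := F.contDiffOn_variationComp hΛ p hp
  have hU := fun z hz => F.variationComp_mem_localDomain hab hΛ p hN hN' hp (z := z) hz
  have e1 := F.fieldComp_longDeriv hab hΛ p hN hN' hp hV
  have e2 := F.fieldComp_transDeriv hab hΛ p hN hN' hp hV
  -- Smoothness of the first covariant derivatives permits applying the chart formulas a second
  -- time.
  have d1 := ((F.isLocalPseudoFinsler p).contDiffOn_longDerivLocal hK hx hU hV).congr e1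
  have d2 := ((F.isLocalPseudoFinsler p).contDiffOn_transDerivLocal hK hx hU hV).congr e2
  rw [variationCurvature, tangentComp_sub]
  have e3 := F.fieldComp_longDeriv hab hΛ p hN hN' hp d2 hz
  have e4 := F.fieldComp_transDeriv hab hΛ p hN hN' hp d1 hz
  rw [longDerivLocal, partialFst_congr e2 hz, e2 hz] at e3
  rw [transDerivLocal, partialSnd_congr e1 hz, e1 hz] at e4
  exact congrArg₂ (· - ·) e3 e4

/-- The covariant derivative along the central curve of a variation. -/
theorem tangentComp_covDerivVelocity {V : ℝ × ℝ → E}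
    (hV : ContDiffOn ℝ ∞ V ((Icc a b ∩ N) ×ˢ (Ioo (-ε) ε ∩ N'))) (h0 : (0 : ℝ) ∈ N')
    (hγ : F.IsGeodesic a b γ) {X : ∀ t, TangentSpace 𝓘(ℝ, E) (γ t)}
    (hX : ∀ t ∈ Icc a b ∩ N,
      -- `V` is any function on the box restricting to the components of `X`, so the lemma can be
      -- iterated to reach second covariant derivatives.
      tangentComp p (⟨γ t, X t⟩ : TangentBundle 𝓘(ℝ, E) M) = V (t, 0)) {t : ℝ}
    (ht : t ∈ Icc a b ∩ N) :
    tangentComp p (⟨γ t, F.covDerivVelocity a b γ X t⟩ : TangentBundle 𝓘(ℝ, E) M) =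
      longDerivLocal (F.localExpr p) ((Icc a b ∩ N) ×ˢ (Ioo (-ε) ε ∩ N')) (variationComp p Λ) V
        (t, 0) := by
  have hs : (0 : ℝ) ∈ Ioo (-ε) ε ∩ N' := ⟨⟨by linarith [hΛ.pos], hΛ.pos⟩, h0⟩
  have hS := uniqueDiffOn_Icc hab t ht.1
  have hb : ∀ τ ∈ Icc a b, Λ τ 0 = γ τ := fun τ hτ =>
    congrArg (fun v : TangentBundle 𝓘(ℝ, E) M => v.1) (hΛ.variation τ hτ)
  have hγp : γ t ∈ (chartAt E p).source := by rw [← hb t ht.1]; exact hp t ht 0 hs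
  have hmd : MDifferentiableWithinAt 𝓘(ℝ, ℝ) 𝓘(ℝ, E) γ (Icc a b) t :=
    (hγ.smooth t ht.1).mdifferentiableWithinAt (by simp)
  have h1 : HasDerivWithinAt (fun τ => tangentComp p (⟨γ τ, X τ⟩ : TangentBundle 𝓘(ℝ, E) M))
      (partialFst ((Icc a b ∩ N) ×ˢ (Ioo (-ε) ε ∩ N')) V (t, 0)) (Icc a b) t := by
    refine (hasDerivWithinAt_inter (hN.mem_nhds ht.2)).1 ?_
    exact ((isBox_inter (ε := ε) hab hN hN').hasDerivWithinAt_fst hV (z := (t, 0))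
      ⟨ht, hs⟩).congr hX (hX t ht)
  have h2 : HasDerivWithinAt (fun τ => chartAt E p (γ τ))
      (partialFst ((Icc a b ∩ N) ×ˢ (Ioo (-ε) ε ∩ N')) (variationComp p Λ) (t, 0))
      (Icc a b) t :=
    (hasDerivWithinAt_Icc hab hN hN' (F.contDiffOn_variationComp hΛ p hp) ht hs).congr
      (fun τ hτ => by rw [variationComp, hb τ hτ]) (by rw [variationComp, hb t ht.1])
  have h3 := F.tangentComp_covDeriv (W := velocity (Icc a b) γ) (X := X) p ht.1 hS hmd hγp
    (hγ.admissible t ht.1) h1.differentiableWithinAt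
  rw [tangentComp_velocity p hS hmd hγp, h1.derivWithin hS, h2.derivWithin hS, hX t ht] at h3
  refine h3.trans ?_
  rw [longDerivLocal, variationComp, hb t ht.1]

end Variation

/-- A Jacobi field solves the linearized Euler-Lagrange equation, in any chart. -/
theorem IsJacobiField.hasDerivWithinAt {F : PseudoFinsler E M} {a b : ℝ} (hab : a < b) {γ : ℝ → M}
    (hγ : F.IsGeodesic a b γ) {J : ∀ t, TangentSpace 𝓘(ℝ, E) (γ t)}
    (hJ : F.IsJacobiField a b γ J) (p : M) {t : ℝ} (ht : t ∈ Icc a b)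
    (hp : γ t ∈ (chartAt E p).source) (e : E) :
    HasDerivWithinAt (fun τ => secondDeriv (F.localExpr p)
        (chartAt E p (γ τ), derivWithin (fun τ => chartAt E p (γ τ)) (Icc a b) τ)
        (tangentComp p (⟨γ τ, J τ⟩ : TangentBundle 𝓘(ℝ, E) M), derivWithin
          (fun τ => tangentComp p (⟨γ τ, J τ⟩ : TangentBundle 𝓘(ℝ, E) M)) (Icc a b) τ) (0, e))
      (secondDeriv (F.localExpr p)
        (chartAt E p (γ t), derivWithin (fun τ => chartAt E p (γ τ)) (Icc a b) t)
        (tangentComp p (⟨γ t, J t⟩ : TangentBundle 𝓘(ℝ, E) M), derivWithin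
          (fun τ => tangentComp p (⟨γ τ, J τ⟩ : TangentBundle 𝓘(ℝ, E) M)) (Icc a b) t) (e, 0))
      (Icc a b) t := by
  obtain ⟨ε, Λ, Z, hΛ, hZ, hR⟩ := hJ.jacobi
  have h0ε : (0 : ℝ) ∈ Ioo (-ε) ε := ⟨by linarith [hΛ.pos], hΛ.pos⟩
  have hb : ∀ τ ∈ Icc a b, Λ τ 0 = γ τ := fun τ hτ =>
    congrArg (fun v : TangentBundle 𝓘(ℝ, E) M => v.1) (hΛ.variation τ hτ)
  -- Continuity of the variation at `(t, 0)` gives a product neighbourhood that it maps into the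
  -- chart domain.
  obtain ⟨N, N', hN, htN, hN', h0, hNN⟩ : ∃ N N' : Set ℝ, IsOpen N ∧ t ∈ N ∧ IsOpen N' ∧
      (0 : ℝ) ∈ N' ∧ ∀ t ∈ Icc a b ∩ N, ∀ s ∈ Ioo (-ε) ε ∩ N', Λ t s ∈ (chartAt E p).source := by
    have hc := hΛ.smooth.continuousOn (t, 0) ⟨ht, h0ε⟩
    have hm := hc ((chartAt E p).open_source.mem_nhds (by
      change Λ t 0 ∈ _
      rwa [hb t ht]))
    obtain ⟨u, hu, hut, hsub⟩ := mem_nhdsWithin.1 hm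
    obtain ⟨N, N', hN, hN', htN, h0, hsub'⟩ := isOpen_prod_iff.1 hu t 0 hut
    exact ⟨N, N', hN, htN, hN', h0, fun τ hτ s hs =>
      hsub (a := (τ, s)) ⟨hsub' ⟨hτ.2, hs.2⟩, hτ.1, hs.1⟩⟩
  have htT : t ∈ Icc a b ∩ N := ⟨ht, htN⟩
  have hs : (0 : ℝ) ∈ Ioo (-ε) ε ∩ N' := ⟨h0ε, h0⟩
  have hK := isBox_inter (ε := ε) hab hN hN'
  have hx := F.contDiffOn_variationComp hΛ p hNN
  have hU := fun z hz => F.variationComp_mem_localDomain hab hΛ p hN hN' hNN (z := z) hz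
  have hF := F.isLocalPseudoFinsler p
  have hxt := hK.contDiffOn_partialFst hx
  have hxs := hK.contDiffOn_partialSnd hx
  have hZc : ContDiffOn ℝ ∞ (fieldComp p Λ Z) ((Icc a b ∩ N) ×ˢ (Ioo (-ε) ε ∩ N')) :=
    ContMDiffOn.contDiffOn_tangentComp
      (hZ.smooth.mono (prod_mono inter_subset_left inter_subset_left)) p
      fun z hz => hNN _ hz.1 _ hz.2
  set K := (Icc a b ∩ N) ×ˢ (Ioo (-ε) ε ∩ N') with hKdef
  set x : ℝ × ℝ → E := variationComp p Λ with hxdef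
  have hcd : ∀ τ ∈ Icc a b ∩ N, HasDerivWithinAt (fun τ => chartAt E p (γ τ))
      (partialFst K x (τ, 0)) (Icc a b) τ := fun τ hτ =>
    (hasDerivWithinAt_Icc hab hN hN' hx hτ hs).congr
      (fun τ hτ => by rw [hxdef, variationComp, hb τ hτ]) (by rw [hxdef, variationComp, hb τ hτ.1])
  have hvel : ∀ τ ∈ Icc a b ∩ N, tangentComp p
      (⟨γ τ, velocity (Icc a b) γ τ⟩ : TangentBundle 𝓘(ℝ, E) M) = partialFst K x (τ, 0) :=
    fun τ hτ => by
      rw [← (hcd τ hτ).derivWithin (uniqueDiffOn_Icc hab τ hτ.1)]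
      refine tangentComp_velocity p (uniqueDiffOn_Icc hab τ hτ.1)
        ((hγ.smooth τ hτ.1).mdifferentiableWithinAt (by simp)) ?_
      rw [← hb τ hτ.1]
      exact hNN τ hτ 0 hs
  have hJc : ∀ τ ∈ Icc a b ∩ N, tangentComp p (⟨γ τ, J τ⟩ : TangentBundle 𝓘(ℝ, E) M) =
      partialSnd K x (τ, 0) := fun τ hτ => by
    rw [← hΛ.variation τ hτ.1]
    exact F.tangentComp_transVelocity hab hΛ p hN hN' hNN hτ hs
  have hgeo : ∀ τ ∈ Icc a b ∩ N,
      longDerivLocal (F.localExpr p) K x (partialFst K x) (τ, 0) = 0 := fun τ hτ => by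
    rw [← F.tangentComp_covDerivVelocity hab hΛ p hN hN' hNN hxt h0 hγ hvel hτ,
      hγ.parallel τ hτ.1]
    exact tangentComp_zero p (γ τ)
  have hZ0 : ∀ τ ∈ Icc a b ∩ N, fieldComp p Λ Z (τ, 0) = partialFst K x (τ, 0) := fun τ hτ => by
    rw [← hvel τ hτ, ← hZ.extends_eq τ hτ.1]
    rfl
  have hjac : longDerivLocal (F.localExpr p) K x
        (longDerivLocal (F.localExpr p) K x (partialSnd K x)) (t, 0) =
      longDerivLocal (F.localExpr p) K x
        (transDerivLocal (F.localExpr p) K x (fieldComp p Λ Z)) (t, 0) -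
      transDerivLocal (F.localExpr p) K x
        (longDerivLocal (F.localExpr p) K x (fieldComp p Λ Z)) (t, 0) := by
    rw [← F.tangentComp_variationCurvature hab hΛ p hN hN' hNN hZc htT hs, hR t ht]
    -- Two applications express `J''`: this one differentiates `J'`, and the next identifies the
    -- components of `J'`.
    refine (F.tangentComp_covDerivVelocity hab hΛ p hN hN' hNN
      (hF.contDiffOn_longDerivLocal hK hx hU hxs) h0 hγ (fun τ hτ => ?_) htT).symm
    exact F.tangentComp_covDerivVelocity hab hΛ p hN hN' hNN hxs h0 hγ hJc hτ
  have hgeo' := hF.partialSnd_longDerivLocal_eq_zero hK hx hU hZc hs hgeo hZ0 htT hjac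
  have hmain := hF.hasDerivWithinAt_secondDeriv hK hx hU hs hgeo htT hgeo' e
  have hJd : ∀ τ ∈ Icc a b ∩ N, derivWithin
      (fun τ => tangentComp p (⟨γ τ, J τ⟩ : TangentBundle 𝓘(ℝ, E) M)) (Icc a b) τ =
      partialFst K (partialSnd K x) (τ, 0) := fun τ hτ => by
    refine HasDerivWithinAt.derivWithin ?_ (uniqueDiffOn_Icc hab τ hτ.1)
    refine (hasDerivWithinAt_inter (hN.mem_nhds hτ.2)).1 ?_
    exact (hK.hasDerivWithinAt_fst hxs (z := (τ, 0)) ⟨hτ, hs⟩).congr hJc (hJc τ hτ)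
  -- The variation is eliminated in favour of `γ` and `J`, so that two Jacobi fields with different
  -- variations can be compared.
  have hrw : ∀ τ ∈ Icc a b ∩ N, ∀ v, secondDeriv (F.localExpr p)
      (chartAt E p (γ τ), derivWithin (fun τ => chartAt E p (γ τ)) (Icc a b) τ)
      (tangentComp p (⟨γ τ, J τ⟩ : TangentBundle 𝓘(ℝ, E) M), derivWithin
        (fun τ => tangentComp p (⟨γ τ, J τ⟩ : TangentBundle 𝓘(ℝ, E) M)) (Icc a b) τ) v =
      secondDeriv (F.localExpr p) (x (τ, 0), partialFst K x (τ, 0))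
        (partialSnd K x (τ, 0), partialFst K (partialSnd K x) (τ, 0)) v := fun τ hτ v => by
    rw [(hcd τ hτ).derivWithin (uniqueDiffOn_Icc hab τ hτ.1), hJd τ hτ, hJc τ hτ, ← hb τ hτ.1]
    rfl
  rw [hrw t htT]
  exact (hasDerivWithinAt_inter (hN.mem_nhds htN)).1
    (hmain.congr (fun τ hτ => hrw τ hτ _) (hrw t htT _))

end PseudoFinsler

/-! ### Conservation of the Lagrange form. -/

namespace PseudoFinsler

variable {E : Type*} [NormedAddCommGroup E] [NormedSpace ℝ E] [FiniteDimensional ℝ E]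
  {M : Type*} [TopologicalSpace M] [ChartedSpace E M] [IsManifold 𝓘(ℝ, E) ∞ M]
  {F : PseudoFinsler E M}

/-- The Lagrange form of two Jacobi fields has zero derivative. -/
theorem hasDerivWithinAt_lagrange {a b : ℝ} (hab : a < b) {γ : ℝ → M}
    (hγ : F.IsGeodesic a b γ) {J₁ J₂ : ∀ t, TangentSpace 𝓘(ℝ, E) (γ t)}
    (hJ₁ : F.IsJacobiField a b γ J₁) (hJ₂ : F.IsJacobiField a b γ J₂) {t : ℝ}
    (ht : t ∈ Icc a b) :
    HasDerivWithinAt (fun t =>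
      F.fundamentalTensor (velocity (Icc a b) γ t) (J₁ t) (F.covDerivVelocity a b γ J₂ t)
        - F.fundamentalTensor (velocity (Icc a b) γ t) (F.covDerivVelocity a b γ J₁ t) (J₂ t))
      0 (Icc a b) t := by
  set p : M := γ t with hpdef
  have hpt : γ t ∈ (chartAt E p).source := mem_chart_source E p
  obtain ⟨N, hN, htN, hNp⟩ : ∃ N : Set ℝ, IsOpen N ∧ t ∈ N ∧
      ∀ τ ∈ Icc a b ∩ N, γ τ ∈ (chartAt E p).source := by
    have hm := hγ.smooth.continuousOn t ht ((chartAt E p).open_source.mem_nhds hpt)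
    obtain ⟨N, hN, htN, hsub⟩ := mem_nhdsWithin.1 hm
    exact ⟨N, hN, htN, fun τ hτ => hsub ⟨hτ.2, hτ.1⟩⟩
  have hS : ∀ τ ∈ Icc a b ∩ N, UniqueDiffWithinAt ℝ (Icc a b) τ := fun τ hτ =>
    uniqueDiffOn_Icc hab τ hτ.1
  have hT : UniqueDiffOn ℝ (Icc a b ∩ N) := (uniqueDiffOn_Icc hab).inter hN
  have hderiv : ∀ {f : ℝ → E}, ContDiffOn ℝ ∞ f (Icc a b ∩ N) →
      (∀ τ ∈ Icc a b ∩ N, HasDerivWithinAt f (derivWithin f (Icc a b) τ) (Icc a b) τ) ∧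
      DifferentiableOn ℝ (derivWithin f (Icc a b)) (Icc a b ∩ N) := by
    intro f hf
    have h1 : ∀ τ ∈ Icc a b ∩ N, HasDerivWithinAt f (derivWithin f (Icc a b) τ) (Icc a b) τ :=
      fun τ hτ => ((hasDerivWithinAt_inter (hN.mem_nhds hτ.2)).1
        (hf.differentiableOn (by simp) τ hτ).hasDerivWithinAt).differentiableWithinAt.hasDerivWithinAt
    refine ⟨h1, ((hf.derivWithin hT (m := ∞) (by simp)).differentiableOn (by simp)).congr
      fun τ hτ => ?_⟩
    exact (derivWithin_inter (hN.mem_nhds hτ.2)).symm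
  set c : ℝ → E := fun τ => chartAt E p (γ τ) with hc
  set j₁ : ℝ → E := fun τ => tangentComp p (⟨γ τ, J₁ τ⟩ : TangentBundle 𝓘(ℝ, E) M) with hj₁
  set j₂ : ℝ → E := fun τ => tangentComp p (⟨γ τ, J₂ τ⟩ : TangentBundle 𝓘(ℝ, E) M) with hj₂
  have sc : ContDiffOn ℝ ∞ c (Icc a b ∩ N) :=
    ContMDiffOn.contDiffOn_chartAt (hγ.smooth.mono inter_subset_left) p hNp
  have s₁ : ContDiffOn ℝ ∞ j₁ (Icc a b ∩ N) :=
    ContMDiffOn.contDiffOn_tangentComp (ContMDiffOn.mono hJ₁.smooth inter_subset_left) p hNp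
  have s₂ : ContDiffOn ℝ ∞ j₂ (Icc a b ∩ N) :=
    ContMDiffOn.contDiffOn_tangentComp (ContMDiffOn.mono hJ₂.smooth inter_subset_left) p hNp
  have hmd : ∀ τ ∈ Icc a b, MDifferentiableWithinAt 𝓘(ℝ, ℝ) 𝓘(ℝ, E) γ (Icc a b) τ := fun τ hτ =>
    (hγ.smooth τ hτ).mdifferentiableWithinAt (by simp)
  have hvel : ∀ τ ∈ Icc a b ∩ N, tangentComp p
      (⟨γ τ, velocity (Icc a b) γ τ⟩ : TangentBundle 𝓘(ℝ, E) M) = derivWithin c (Icc a b) τ :=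
    fun τ hτ => tangentComp_velocity p (hS τ hτ) (hmd τ hτ.1) (hNp τ hτ)
  have hU : ∀ τ ∈ Icc a b ∩ N, (c τ, derivWithin c (Icc a b) τ) ∈ F.localDomain p :=
    fun τ hτ => by
      rw [← hvel τ hτ]
      exact F.mem_localDomain p (v := ⟨γ τ, velocity (Icc a b) γ τ⟩) (hNp τ hτ)
        (hγ.admissible τ hτ.1)
  have hcov : ∀ {J : ∀ t, TangentSpace 𝓘(ℝ, E) (γ t)},
      ContDiffOn ℝ ∞ (fun τ => tangentComp p (⟨γ τ, J τ⟩ : TangentBundle 𝓘(ℝ, E) M))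
        (Icc a b ∩ N) → ∀ τ ∈ Icc a b ∩ N,
      tangentComp p (⟨γ τ, F.covDerivVelocity a b γ J τ⟩ : TangentBundle 𝓘(ℝ, E) M) =
        derivWithin (fun τ => tangentComp p (⟨γ τ, J τ⟩ : TangentBundle 𝓘(ℝ, E) M)) (Icc a b) τ
        + chernMap (F.localExpr p) (c τ, derivWithin c (Icc a b) τ)
          (tangentComp p (⟨γ τ, J τ⟩ : TangentBundle 𝓘(ℝ, E) M)) (derivWithin c (Icc a b) τ) := by
    intro J hJ τ hτ
    rw [← hvel τ hτ]
    have h1 := F.tangentComp_covDeriv (W := velocity (Icc a b) γ) (X := J) p hτ.1 (hS τ hτ)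
      (hmd τ hτ.1) (hNp τ hτ) (hγ.admissible τ hτ.1) ((hderiv hJ).1 τ hτ).differentiableWithinAt
    rw [show derivWithin (fun τ => chartAt E p (γ τ)) (Icc a b) τ = _ from (hvel τ hτ).symm] at h1
    exact h1
  have hF := F.isLocalPseudoFinsler p
  have hω := hF.hasDerivWithinAt_symplectic (T := Icc a b ∩ N) ⟨ht, htN⟩ hT hU
    (sc.differentiableOn (by simp)) (hderiv sc).2
    (fun τ hτ => ((hderiv s₁).1 τ hτ).mono inter_subset_left) (hderiv s₁).2
    (fun τ hτ => ((hderiv s₂).1 τ hτ).mono inter_subset_left) (hderiv s₂).2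
    (fun e => (hJ₁.hasDerivWithinAt hab hγ p ht hpt e).mono inter_subset_left)
    (fun e => (hJ₂.hasDerivWithinAt hab hγ p ht hpt e).mono inter_subset_left)
  -- Near `t` the intrinsic Lagrange form is half the symplectic form in the chart; the factor is
  -- the one in the fundamental tensor.
  have heq : ∀ τ ∈ Icc a b ∩ N,
      F.fundamentalTensor (velocity (Icc a b) γ τ) (J₁ τ) (F.covDerivVelocity a b γ J₂ τ)
        - F.fundamentalTensor (velocity (Icc a b) γ τ) (F.covDerivVelocity a b γ J₁ τ) (J₂ τ) =
      1 / 2 * (secondDeriv (F.localExpr p) (c τ, derivWithin c (Icc a b) τ)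
          (j₂ τ, derivWithin j₂ (Icc a b) τ) (0, j₁ τ)
        - secondDeriv (F.localExpr p) (c τ, derivWithin c (Icc a b) τ)
          (j₁ τ, derivWithin j₁ (Icc a b) τ) (0, j₂ τ)) := fun τ hτ => by
    rw [F.fundamentalTensor_eq p (hNp τ hτ) _ _ _ (hγ.admissible τ hτ.1),
      F.fundamentalTensor_eq p (hNp τ hτ) _ _ _ (hγ.admissible τ hτ.1), hvel τ hτ,
      hcov s₁ τ hτ, hcov s₂ τ hτ, ← mul_sub]
    congr 1
    exact hF.secondDeriv_skew (hU τ hτ) _ _ _ _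
  refine (hasDerivWithinAt_inter (hN.mem_nhds htN)).1 ?_
  refine HasDerivWithinAt.congr ?_ heq (heq t ⟨ht, htN⟩)
  exact (hω.const_mul (1 / 2)).congr_deriv (mul_zero _)

end PseudoFinsler

end

theorem proposition3p18 {E : Type*} [NormedAddCommGroup E] [NormedSpace ℝ E]
    [FiniteDimensional ℝ E] {M : Type*} [TopologicalSpace M] [T2Space M] [ChartedSpace E M]
    [IsManifold 𝓘(ℝ, E) ∞ M] (F : PseudoFinsler E M) {a b : ℝ} (hab : a < b)
    (γ : ℝ → M) (hγ : F.IsGeodesic a b γ)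
    (J₁ J₂ : ∀ t, TangentSpace 𝓘(ℝ, E) (γ t))
    (hJ₁ : F.IsJacobiField a b γ J₁) (hJ₂ : F.IsJacobiField a b γ J₂) :
    ∃ κ : ℝ, ∀ t ∈ Icc a b,
      F.fundamentalTensor (velocity (Icc a b) γ t) (J₁ t) (F.covDerivVelocity a b γ J₂ t)
        - F.fundamentalTensor (velocity (Icc a b) γ t) (F.covDerivVelocity a b γ J₁ t) (J₂ t)
        = κ := by
  have hd := fun t (ht : t ∈ Icc a b) =>
    PseudoFinsler.hasDerivWithinAt_lagrange hab hγ hJ₁ hJ₂ ht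
  -- The constant is the value at `a`.
  exact ⟨_, constant_of_derivWithin_zero (fun t ht => (hd t ht).differentiableWithinAt)
    fun t ht => (hd t ⟨ht.1, ht.2.le⟩).derivWithin (uniqueDiffOn_Icc hab t ⟨ht.1, ht.2.le⟩)⟩
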